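/- Let $\mathbb K=\mathbb R$ (with "smooth" meaning $C^\infty$) or $\mathbb K=\mathbb C$ (with "smooth" meaning holomorphic). Let $V\subset\mathbb K^2$ be open and let a 3-web on $V$ be given by smooth 1-forms $\omega_1,\omega_2,\omega_3=-(\omega_1+\omega_2)$, with $\omega_1\wedge\omega_2$ nowhere zero, the leaves of the $i$-th foliation being the integral curves of $\omega_i=0$. Write $df=f_2\omega_1-f_1\omega_2$ for a function $f$ (and $f_{ij}=(f_i)_j$), $d\omega_1=\alpha\,\omega_1\wedge\omega_2$, $d\omega_2=\beta\,\omega_1\wedge\omega_2$. Let $\gamma=\beta\omega_1-\alpha\omega_2$ be the Chern connection form of the web ($d\omega_i=\gamma\wedge\omega_i$), and suppose that the forms are normalized so that the Blaschke curvature is $d\gamma=\omega_1\wedge\omega_2$, that is, $\beta_1-\alpha_2=1$ (in particular, the web is not hexagonal near any point of $V$). For a smooth non-vanishing function $N$ put $U_i=\omega_i/N$, $$a=\tfrac{N^2}{3}+\left(\tfrac{2\beta}{3}+\tfrac{\alpha}{3}\right)N-\tfrac{N_1}{3}-\tfrac{2N_2}{3},\quad b=\tfrac{N^2}{3}-\left(\tfrac{\beta}{3}+\tfrac{2\alpha}{3}\right)N+\tfrac{2N_1}{3}+\tfrac{N_2}{3},\quad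 c=\tfrac{N^2}{3}+\left(\tfrac{\alpha}{3}-\tfrac{\beta}{3}\right)N-\tfrac{N_1}{3}+\tfrac{N_2}{3},$$ $$\Omega_N=\begin{pmatrix}\frac{1-2a-c}{3}U_3-\frac{1+2a+b}{3}U_2& bU_2& cU_3\\ aU_1&\frac{1-2b-a}{3}U_1-\frac{1+2b+c}{3}U_3& cU_3\\ aU_1& bU_2&\frac{1-2c-b}{3}U_2-\frac{1+2c+a}{3}U_1\end{pmatrix}.$$ Let $\mathfrak{aff}(2)\subset\mathfrak{sl}(3)$ be the Lie algebra of the stabilizer in $SL(3)$ of the point $[1:1:1]\in\mathbb P^2$. (1) For every smooth non-vanishing $N$ on $V$, $\Omega_N$ is a smooth $\mathfrak{sl}(3)$-valued form that defines a projective Cartan connection with the model $(\mathfrak{sl}(3),\mathfrak{aff}(2))$, that is, $T_pV\xrightarrow{\Omega_N}\mathfrak{sl}(3)\to\mathfrak{sl}(3)/\mathfrak{aff}(2)$ is an isomorphism for all $p\in V$. It is torsion-free: its curvature $K=d\Omega_N+\Omega_N\wedge\Omega_N$ takes values in $\mathfrak{aff}(2)$. The leaves of the three foliations are geodesics: along an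 arc of a leaf, the solution $F$ of $F'=F\,\Omega_N(c')$, $F(s_0)=e$, in $SL(3)$ is such that $[F(s)(1,1,1)^T]$ stays on a line of $\mathbb P^2$. All three rows of $K$ are equal to $(K_{11},\,K_{22},\,-K_{11}-K_{22})\,\omega_1\wedge\omega_2$, where $$K_{11}=\tfrac{2N_1^2+4N_1N_2+N_1+2N_2}{3N^2}-\tfrac{N_{11}+N_{12}+N_{21}}{3N}-\tfrac{(\alpha+\beta)N_1+\alpha N_2}{N}-\tfrac{\alpha+2\beta}{3N}+\tfrac{2\alpha N}{3}+\tfrac{2\alpha^2+4\alpha\beta+\alpha_1+\alpha_2+\beta_1}{3},$$ $$K_{22}=\tfrac{N_{22}+N_{12}+N_{21}}{3N}-\tfrac{2N_2^2+4N_1N_2+2N_1+N_2}{3N^2}+\tfrac{\beta N_1+(\alpha+\beta)N_2}{N}+\tfrac{2\alpha+\beta}{3N}+\tfrac{2\beta N}{3}-\tfrac{2\beta^2+4\alpha\beta+\beta_1+\beta_2+\alpha_2}{3},$$ so that the connection is flat ($K=0$) if and only if $K_{11}=K_{22}=0$. (2) The web is linearizable if and only if some $N$ makes this connection flat, in the following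 local sense. A linearization on an open set is a local diffeomorphism into $\mathbb K^2$ that maps the leaves of all three foliations into straight lines. For every open $W\subset V$, the web admits linearizations near all points of some open dense subset of $W$ if and only if there are an open dense subset $W_0$ of $W$ and a smooth non-vanishing $N$ on $W_0$ for which $\Omega_N$ is flat. More precisely: if $\Omega_N$ is flat for a smooth non-vanishing $N$ on $W$, then the web admits a linearization near every point of $W$; and if the web admits a linearization on $W$, then $\Omega_N$ is flat for some smooth non-vanishing $N$ on some open dense subset of $W$. -/

import Mathlib

open Metric
open scoped ContDiff Manifold Matrix

noncomputable section

namespace PlanarWeb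

/-- The coordinate plane over the ground field. -/
abbrev Plane (𝕜 : Type*) := 𝕜 × 𝕜

/-- Differential 1-forms on the plane, as fields of covectors. -/
abbrev OneForm (𝕜 : Type*) [RCLike 𝕜] := Plane 𝕜 → (Plane 𝕜 →L[𝕜] 𝕜)

/-- Differential 2-forms on the plane, through their values on pairs of tangent vectors. -/
abbrev TwoForm (𝕜 : Type*) := Plane 𝕜 → Plane 𝕜 → Plane 𝕜 → 𝕜

/-- Matrix-valued 1-forms, as matrices of scalar 1-forms. -/
abbrev MatForm (𝕜 : Type*) [RCLike 𝕜] := Matrix (Fin 3) (Fin 3) (OneForm 𝕜)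

variable {𝕜 : Type*} [RCLike 𝕜]

/-- The wedge product of two 1-forms. -/
def wedge (θ η : OneForm 𝕜) : TwoForm 𝕜 :=
  fun p u v => θ p u * η p v - θ p v * η p u

/-- The exterior derivative of a 1-form. -/
def extD (θ : OneForm 𝕜) : TwoForm 𝕜 :=
  fun p u v => fderiv 𝕜 θ p u v - fderiv 𝕜 θ p v u

/-- `extD` is Mathlib's exterior derivative, written out for 1-forms. -/
theorem extD_eq_extDeriv (θ : OneForm 𝕜) (p u v : Plane 𝕜) (h : DifferentiableAt 𝕜 θ p) :
    extD θ p u v =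
      extDeriv (fun x => ContinuousAlternatingMap.ofSubsingleton 𝕜 (Plane 𝕜) 𝕜 (0 : Fin 1) (θ x))
        p ![u, v] := by
  rw [extDeriv_apply]
  · have hd : ∀ w z : Plane 𝕜, fderiv 𝕜 (fun x => θ x w) p z = fderiv 𝕜 θ p z w := by
      intro w z
      rw [fderiv_clm_apply h (differentiableAt_const w)]
      simp
    simp [Fin.sum_univ_two, extD, hd, Fin.removeNth, sub_eq_add_neg]
  · exact (ContinuousAlternatingMap.ofSubsingletonLIE (𝕜 := 𝕜) (E := Plane 𝕜) (F := 𝕜)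
      (0 : Fin 1)).toContinuousLinearEquiv.differentiableAt.comp p h

/-- The third form of the web, `ω₃ = -(ω₁ + ω₂)`. -/
def third (ω₁ ω₂ : OneForm 𝕜) : OneForm 𝕜 := fun p => -(ω₁ p + ω₂ p)

/-- The coefficient `f` in `η = f ω₁ ∧ ω₂`. -/
def coeff (ω₁ ω₂ : OneForm 𝕜) (η : TwoForm 𝕜) (p : Plane 𝕜) : 𝕜 :=
  η p (1, 0) (0, 1) / wedge ω₁ ω₂ p (1, 0) (0, 1)

/-- The derivative `f₁`, where `df = f₂ ω₁ - f₁ ω₂`. -/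
def D₁ (ω₁ ω₂ : OneForm 𝕜) (f : Plane 𝕜 → 𝕜) : Plane 𝕜 → 𝕜 :=
  coeff ω₁ ω₂ (wedge (fderiv 𝕜 f) ω₁)

/-- The derivative `f₂`, where `df = f₂ ω₁ - f₁ ω₂`. -/
def D₂ (ω₁ ω₂ : OneForm 𝕜) (f : Plane 𝕜 → 𝕜) : Plane 𝕜 → 𝕜 :=
  coeff ω₁ ω₂ (wedge (fderiv 𝕜 f) ω₂)

theorem fderiv_eq_D (ω₁ ω₂ : OneForm 𝕜) (f : Plane 𝕜 → 𝕜) (p u : Plane 𝕜)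
    (h : wedge ω₁ ω₂ p (1, 0) (0, 1) ≠ 0) :
    fderiv 𝕜 f p u = D₂ ω₁ ω₂ f p * ω₁ p u - D₁ ω₁ ω₂ f p * ω₂ p u := by
  have hu : u = u.1 • ((1, 0) : Plane 𝕜) + u.2 • ((0, 1) : Plane 𝕜) := by ext <;> simp
  rw [hu]
  simp only [map_add, map_smul, smul_eq_mul, D₁, D₂, coeff]
  rw [div_mul_eq_mul_div, div_mul_eq_mul_div, ← sub_div, eq_div_iff h]
  simp only [wedge]
  ring

/-- The function `α` in `dω₁ = α ω₁ ∧ ω₂`. -/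
def alpha (ω₁ ω₂ : OneForm 𝕜) : Plane 𝕜 → 𝕜 := coeff ω₁ ω₂ (extD ω₁)

/-- The function `β` in `dω₂ = β ω₁ ∧ ω₂`. -/
def beta (ω₁ ω₂ : OneForm 𝕜) : Plane 𝕜 → 𝕜 := coeff ω₁ ω₂ (extD ω₂)

/-- The Chern connection form `γ` of the web, characterized by `dωᵢ = γ ∧ ωᵢ`. -/
def chern (ω₁ ω₂ : OneForm 𝕜) : OneForm 𝕜 :=
  fun p => beta ω₁ ω₂ p • ω₁ p - alpha ω₁ ω₂ p • ω₂ p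

theorem extD_eq_chern_wedge (ω₁ ω₂ : OneForm 𝕜) (p : Plane 𝕜)
    (h : wedge ω₁ ω₂ p (1, 0) (0, 1) ≠ 0) :
    extD ω₁ p (1, 0) (0, 1) = wedge (chern ω₁ ω₂) ω₁ p (1, 0) (0, 1) ∧
      extD ω₂ p (1, 0) (0, 1) = wedge (chern ω₁ ω₂) ω₂ p (1, 0) (0, 1) := by
  have h1 : extD ω₁ p (1, 0) (0, 1) = alpha ω₁ ω₂ p * wedge ω₁ ω₂ p (1, 0) (0, 1) := by
    simp only [alpha, coeff]; field_simp
  have h2 : extD ω₂ p (1, 0) (0, 1) = beta ω₁ ω₂ p * wedge ω₁ ω₂ p (1, 0) (0, 1) := by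
    simp only [beta, coeff]; field_simp
  rw [h1, h2]
  simp only [wedge, chern, sub_apply, smul_apply,
    smul_eq_mul]
  constructor <;> ring

/-- The smooth forms `ω₁, ω₂, ω₃ = -(ω₁ + ω₂)` define a 3-web on `V` (they are pairwise
independent at every point, the leaves of the `i`-th foliation being the integral curves of
`ωᵢ = 0`), and are normalized so that its Blaschke curvature `dγ` equals `ω₁ ∧ ω₂`. -/
structure IsNormalizedWeb (V : Set (Plane 𝕜)) (ω₁ ω₂ : OneForm 𝕜) : Prop where
  smooth₁ : ContDiffOn 𝕜 ∞ ω₁ V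
  smooth₂ : ContDiffOn 𝕜 ∞ ω₂ V
  independent : ∀ p ∈ V, wedge ω₁ ω₂ p (1, 0) (0, 1) ≠ 0
  curvature : ∀ p ∈ V, ∀ u v, extD (chern ω₁ ω₂) p u v = wedge ω₁ ω₂ p u v

/-- `c` is a regular smooth arc, parametrized by the ball of centre `s₀` and radius `r` in `𝕜` (an
interval if `𝕜 = ℝ`, a disc if `𝕜 = ℂ`), in a leaf of the foliation `θ = 0` of `V`. -/
def IsLeafArc (θ : OneForm 𝕜) (V : Set (Plane 𝕜)) (s₀ : 𝕜) (r : ℝ) (c : 𝕜 → Plane 𝕜) : Prop :=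
  ContDiffOn 𝕜 ∞ c (ball s₀ r) ∧
    ∀ s ∈ ball s₀ r, c s ∈ V ∧ deriv c s ≠ 0 ∧ θ (c s) (deriv c s) = 0

/-! ### Linearizations -/

/-- `φ` maps the foliation `θ = 0` of `U` to a foliation by straight lines. -/
def Straightens (θ : OneForm 𝕜) (U : Set (Plane 𝕜)) (φ : Plane 𝕜 → Plane 𝕜) : Prop :=
  ∀ (s₀ : 𝕜) (r : ℝ) (c : 𝕜 → Plane 𝕜), IsLeafArc θ U s₀ r c →
    Collinear 𝕜 ((fun s => φ (c s)) '' ball s₀ r)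

/-- `φ` is a local diffeomorphism on `U` that maps the web to a linear web. -/
def IsLinearization (ω₁ ω₂ : OneForm 𝕜) (U : Set (Plane 𝕜)) (φ : Plane 𝕜 → Plane 𝕜) : Prop :=
  IsLocalDiffeomorphOn 𝓘(𝕜, Plane 𝕜) 𝓘(𝕜, Plane 𝕜) ∞ φ U ∧
    Straightens ω₁ U φ ∧ Straightens ω₂ U φ ∧ Straightens (third ω₁ ω₂) U φ

/-- The web admits a linearization on some neighbourhood of `p`. -/
def LinearizableNear (ω₁ ω₂ : OneForm 𝕜) (p : Plane 𝕜) : Prop :=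
  ∃ U : Set (Plane 𝕜), IsOpen U ∧ p ∈ U ∧ ∃ φ, IsLinearization ω₁ ω₂ U φ

/-! ### The matrix form `Ω` -/

/-- The 𝔰𝔩(3)-valued form built from `U₁, U₂, U₃ = -(U₁ + U₂)` and the functions `a, b, c`. -/
def omegaForm (U₁ U₂ : OneForm 𝕜) (a b c : Plane 𝕜 → 𝕜) : MatForm 𝕜 :=
  !![fun p => ((1 - 2 * a p - c p) / 3) • third U₁ U₂ p - ((1 + 2 * a p + b p) / 3) • U₂ p,
      fun p => b p • U₂ p,
      fun p => c p • third U₁ U₂ p;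
     fun p => a p • U₁ p,
      fun p => ((1 - 2 * b p - a p) / 3) • U₁ p - ((1 + 2 * b p + c p) / 3) • third U₁ U₂ p,
      fun p => c p • third U₁ U₂ p;
     fun p => a p • U₁ p,
      fun p => b p • U₂ p,
      fun p => ((1 - 2 * c p - b p) / 3) • U₂ p - ((1 + 2 * c p + a p) / 3) • U₁ p]

section invariants

variable (ω₁ ω₂ : OneForm 𝕜) (N : Plane 𝕜 → 𝕜)

/-- The function `a` determined by `N`. -/
def aFun (p : Plane 𝕜) : 𝕜 :=
  N p ^ 2 / 3 + (2 * beta ω₁ ω₂ p / 3 + alpha ω₁ ω₂ p / 3) * N p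
    - D₁ ω₁ ω₂ N p / 3 - 2 * D₂ ω₁ ω₂ N p / 3

/-- The function `b` determined by `N`. -/
def bFun (p : Plane 𝕜) : 𝕜 :=
  N p ^ 2 / 3 - (beta ω₁ ω₂ p / 3 + 2 * alpha ω₁ ω₂ p / 3) * N p
    + 2 * D₁ ω₁ ω₂ N p / 3 + D₂ ω₁ ω₂ N p / 3

/-- The function `c` determined by `N`. -/
def cFun (p : Plane 𝕜) : 𝕜 :=
  N p ^ 2 / 3 + (alpha ω₁ ω₂ p / 3 - beta ω₁ ω₂ p / 3) * N p
    - D₁ ω₁ ω₂ N p / 3 + D₂ ω₁ ω₂ N p / 3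

/-- The form `Ω_N`, with `Uᵢ = ωᵢ / N` and the functions `a, b, c` determined by `N`. -/
def OmegaN : MatForm 𝕜 :=
  omegaForm (fun p => (N p)⁻¹ • ω₁ p) (fun p => (N p)⁻¹ • ω₂ p)
    (aFun ω₁ ω₂ N) (bFun ω₁ ω₂ N) (cFun ω₁ ω₂ N)

/-- The curvature component `K₁₁` of `Ω_N`; below `Nᵢⱼ` is the `j`-th derivative of `Nᵢ`. -/
def K₁₁ (p : Plane 𝕜) : 𝕜 :=
  let α := alpha ω₁ ω₂
  let β := beta ω₁ ω₂
  let N₁ := D₁ ω₁ ω₂ N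
  let N₂ := D₂ ω₁ ω₂ N
  (2 * N₁ p ^ 2 + 4 * N₁ p * N₂ p + N₁ p + 2 * N₂ p) / (3 * N p ^ 2)
    - (D₁ ω₁ ω₂ N₁ p + D₂ ω₁ ω₂ N₁ p + D₁ ω₁ ω₂ N₂ p) / (3 * N p)
    - ((α p + β p) * N₁ p + α p * N₂ p) / N p - (α p + 2 * β p) / (3 * N p)
    + 2 * α p * N p / 3
    + (2 * α p ^ 2 + 4 * α p * β p + D₁ ω₁ ω₂ α p + D₂ ω₁ ω₂ α p + D₁ ω₁ ω₂ β p) / 3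

/-- The curvature component `K₂₂` of `Ω_N`. -/
def K₂₂ (p : Plane 𝕜) : 𝕜 :=
  let α := alpha ω₁ ω₂
  let β := beta ω₁ ω₂
  let N₁ := D₁ ω₁ ω₂ N
  let N₂ := D₂ ω₁ ω₂ N
  (D₂ ω₁ ω₂ N₂ p + D₂ ω₁ ω₂ N₁ p + D₁ ω₁ ω₂ N₂ p) / (3 * N p)
    - (2 * N₂ p ^ 2 + 4 * N₁ p * N₂ p + 2 * N₁ p + N₂ p) / (3 * N p ^ 2)
    + (β p * N₁ p + (α p + β p) * N₂ p) / N p + (2 * α p + β p) / (3 * N p)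
    + 2 * β p * N p / 3
    - (2 * β p ^ 2 + 4 * α p * β p + D₁ ω₁ ω₂ β p + D₂ ω₁ ω₂ β p + D₂ ω₁ ω₂ α p) / 3

/-- `N` is smooth and vanishes nowhere on `W`. -/
def IsAdmissible (W : Set (Plane 𝕜)) : Prop :=
  ContDiffOn 𝕜 ∞ N W ∧ ∀ p ∈ W, N p ≠ 0

end invariants

/-! ### Projective Cartan connections -/

/-- The value of a matrix-valued 1-form on a tangent vector. -/
def evalForm (Ω : MatForm 𝕜) (p v : Plane 𝕜) : Matrix (Fin 3) (Fin 3) 𝕜 :=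
  Matrix.of fun i j => Ω i j p v

/-- The value of the curvature `K = dΩ + Ω ∧ Ω` on a pair of tangent vectors. -/
def curv (Ω : MatForm 𝕜) (p u v : Plane 𝕜) : Matrix (Fin 3) (Fin 3) 𝕜 :=
  Matrix.of fun i j => extD (Ω i j) p u v + ∑ k, wedge (Ω i k) (Ω k j) p u v

/-- The subalgebra 𝔞𝔣𝔣(2) of 𝔰𝔩(3): the Lie algebra of the stabilizer of the point `[1 : 1 : 1]` of
the projective plane, that is, the trace-free matrices that map `(1, 1, 1)` to a multiple of
itself. -/
def aff2 (𝕜 : Type*) [RCLike 𝕜] :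
    LieSubalgebra 𝕜 (LieAlgebra.SpecialLinear.sl (Fin 3) 𝕜) where
  carrier := {A | ∃ l : 𝕜, (A : Matrix (Fin 3) (Fin 3) 𝕜) *ᵥ 1 = l • 1}
  zero_mem' := ⟨0, by simp⟩
  add_mem' := by
    rintro A B ⟨l, hl⟩ ⟨m, hm⟩
    exact ⟨l + m, by simp [Matrix.add_mulVec, hl, hm, add_smul]⟩
  smul_mem' := by
    rintro t A ⟨l, hl⟩
    exact ⟨t * l, by simp [Matrix.smul_mulVec, hl, mul_smul]⟩
  lie_mem' := by
    rintro A B ⟨l, hl⟩ ⟨m, hm⟩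
    refine ⟨0, ?_⟩
    rw [LieAlgebra.SpecialLinear.sl_bracket, Matrix.sub_mulVec, ← Matrix.mulVec_mulVec,
      ← Matrix.mulVec_mulVec, hl, hm, Matrix.mulVec_smul, Matrix.mulVec_smul, hl, hm,
      smul_smul, smul_smul, mul_comm, sub_self, zero_smul]

/-- `Ω` is a Cartan gauge on `V` with the model (𝔰𝔩(3), 𝔞𝔣𝔣(2)): a smooth 𝔰𝔩(3)-valued 1-form such
that the map `T_pV → 𝔰𝔩(3) → 𝔰𝔩(3)/𝔞𝔣𝔣(2)` is an isomorphism at every point `p`. -/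
def IsCartanGauge (V : Set (Plane 𝕜)) (Ω : MatForm 𝕜) : Prop :=
  (∀ i j, ContDiffOn 𝕜 ∞ (Ω i j) V) ∧
    ∃ h : ∀ p ∈ V, ∀ v, evalForm Ω p v ∈ LieAlgebra.SpecialLinear.sl (Fin 3) 𝕜,
      ∀ (p : Plane 𝕜) (hp : p ∈ V),
        Function.Bijective fun v => (aff2 𝕜).toSubmodule.mkQ ⟨evalForm Ω p v, h p hp v⟩

/-- The Cartan connection has no torsion on `V`: its curvature takes values in 𝔞𝔣𝔣(2). -/
def IsTorsionFree (V : Set (Plane 𝕜)) (Ω : MatForm 𝕜) : Prop :=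
  ∀ p ∈ V, ∀ u v, ∃ h : curv Ω p u v ∈ LieAlgebra.SpecialLinear.sl (Fin 3) 𝕜,
    (⟨curv Ω p u v, h⟩ : LieAlgebra.SpecialLinear.sl (Fin 3) 𝕜) ∈ aff2 𝕜

/-- The Cartan connection is flat on `V`. -/
def IsFlat (V : Set (Plane 𝕜)) (Ω : MatForm 𝕜) : Prop :=
  ∀ p ∈ V, ∀ u v, curv Ω p u v = 0

/-- `F` is the development in `SL(3)`, along the arc `c`, of the Cartan connection: `F' = F Ω(c')`
and `F(s₀)` is the identity. -/
def IsDevelopment (Ω : MatForm 𝕜) (s₀ : 𝕜) (r : ℝ) (c : 𝕜 → Plane 𝕜)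
    (F : 𝕜 → Matrix.SpecialLinearGroup (Fin 3) 𝕜) : Prop :=
  F s₀ = 1 ∧ ∀ s ∈ ball s₀ r, ∀ i j,
    HasDerivAt (fun t => (F t : Matrix (Fin 3) (Fin 3) 𝕜) i j)
      (((F s : Matrix (Fin 3) (Fin 3) 𝕜) * evalForm Ω (c s) (deriv c s)) i j) s

/-- The arc `c` is a geodesic: its development `F` exists and carries `(1, 1, 1)` along a line, of
equation `ℓ = 0`, of the projective plane. -/
def IsGeodesicArc (Ω : MatForm 𝕜) (s₀ : 𝕜) (r : ℝ) (c : 𝕜 → Plane 𝕜) : Prop :=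
  ∃ F, IsDevelopment Ω s₀ r c F ∧ ∃ ℓ : Fin 3 → 𝕜, ℓ ≠ 0 ∧
    ∀ s ∈ ball s₀ r, ℓ ⬝ᵥ ((F s : Matrix (Fin 3) (Fin 3) 𝕜) *ᵥ 1) = 0

/-- The leaves of the foliation `θ = 0` of `V` are geodesics. -/
def LeavesAreGeodesics (θ : OneForm 𝕜) (V : Set (Plane 𝕜)) (Ω : MatForm 𝕜) : Prop :=
  ∀ (s₀ : 𝕜) (r : ℝ) (c : 𝕜 → Plane 𝕜), IsLeafArc θ V s₀ r c → IsGeodesicArc Ω s₀ r c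

/-- `W₀` is an open dense subset of `W`. -/
def IsOpenDenseIn (W₀ W : Set (Plane 𝕜)) : Prop :=
  IsOpen W₀ ∧ W₀ ⊆ W ∧ W ⊆ closure W₀

end PlanarWeb

end

open PlanarWeb

/-!
Write `e₁, e₂` for the vector fields with `f₁ = df e₁`, `f₂ = df e₂`. They are tangent to the first
two foliations, and `e₁ + e₂` is tangent to the third.

**The connection.** The curvature of `Ω_N` is a computation in the frame `e₁, e₂`; it uses only the
commutation rule `f₂₁ = f₁₂ - α f₂ + β f₁` (`D_commutator`) and the normalization `β₁ - α₂ = 1`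
(`D₁_beta`). The value of `Ω_N` on `(1, 1, 1)` is `(-U₂, U₁, 0)` modulo `(1, 1, 1)`
(`evalForm_OmegaN_mulVec_one`), hence the isomorphism with `𝔰𝔩(3)/𝔞𝔣𝔣(2)`. On a vector tangent to
the `i`-th foliation, `Ω_N` preserves the line of the `i`-th basis vector of `𝕜³` and the plane
spanned by it and `(1, 1, 1)` (`PreservesFlag`). Thus the development is solved by quadratures, and moves
`(1, 1, 1)` in a fixed plane (`exists_line_of_preservesFlag`).

**Flat implies linearizable.** If `K = 0`, the system `dF = F Ω_N` is integrable and has a local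
solution `F` with `F = 1` at a given point (`exists_hasFDerivAt_of_commuting`, a Frobenius theorem
for total differential equations over `ℝ` or `ℂ`). The map `p ↦ [F(p) (1, 1, 1)]` into the
projective plane, read in an affine chart, is a linearization (`linearizableNear_of_isFlat`).

**Linearizable implies flat.** The affine coordinates `f` of a linearization satisfy a second-order
linear system
`f₁₁ = (g + 2B - α) f₁`, `f₁₂ = (C - β) f₁ + B f₂`, `f₂₁ = C f₁ + (B - α) f₂`,
`f₂₂ = (g + 2C - β) f₂`: the first and last equations say that the leaves of the first two
foliations are mapped into lines, and that the two coefficients share the same `g` is the condition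
on the third foliation. The integrability conditions of the system are equations for `g` and two
combinations `X`, `Y` of `B`, `C` and their derivatives (`exists_integrabilityEquations`). They
imply that `N = 1/g` makes `Ω_N` flat where `g ≠ 0` (`IntegrabilityEquations.isFlat`), and that `g`
vanishes on no nonempty open set, since there `α = β = 0`, contrary to `β₁ - α₂ = 1`
(`IntegrabilityEquations.exists_ne_zero`). Flatness being a condition on the germs of `N`, functions
given on disjoint open sets are glued (`exists_isFlat_isOpenDenseIn`).
-/

noncomputable section

namespace PlanarWeb

open Set Filter Topology

/-! ### Total differential equations -/

/-- Grönwall's inequality on `[0, 1]` with Lipschitz constant `1`; the factor `2` bounds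
`e - 1`. -/
theorem norm_le_two_mul_of_norm_deriv_le {X : Type*} [NormedAddCommGroup X] [NormedSpace ℝ X]
    {R R' : ℝ → X} {ε : ℝ}
    (hR : ∀ t ∈ Icc (0 : ℝ) 1, HasDerivWithinAt R (R' t) (Icc 0 1) t) (h0 : R 0 = 0)
    (hε : 0 ≤ ε) (hb : ∀ t ∈ Icc (0 : ℝ) 1, ‖R' t‖ ≤ ‖R t‖ + ε) :
    ∀ t ∈ Icc (0 : ℝ) 1, ‖R t‖ ≤ 2 * ε := by
  intro t ht
  have h := norm_le_gronwallBound_of_norm_deriv_right_le (f := R) (f' := R') (δ := 0) (K := 1)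
    (ε := ε) (a := 0) (b := 1) (fun s hs => (hR s hs).continuousWithinAt)
    (fun s hs => (hR s (Ico_subset_Icc_self hs)).mono_of_mem_nhdsWithin
      (Icc_mem_nhdsGE_of_mem hs)) (by simp [h0])
    (fun s hs => by simpa using hb s (Ico_subset_Icc_self hs)) t ht
  rw [gronwallBound_of_K_ne_0 one_ne_zero] at h
  have he : Real.exp t ≤ 3 :=
    (Real.exp_le_exp.2 ht.2).trans (Real.exp_one_lt_d9.le.trans (by norm_num))
  simp only [zero_mul, div_one, one_mul, sub_zero, zero_add] at h
  nlinarith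

/-- The Picard–Lindelöf theorem on `[0, 1]`, keeping the solution inside the ball. -/
theorem exists_solution_mem_closedBall {X : Type*} [NormedAddCommGroup X] [NormedSpace ℝ X]
    [CompleteSpace X] {f : X → X} {x₀ : X} {a K : NNReal}
    (hl : LipschitzOnWith K f (closedBall x₀ a)) (hb : ∀ x ∈ closedBall x₀ a, ‖f x‖ ≤ a) :
    ∃ G : ℝ → X, G 0 = x₀ ∧ (∀ t, G t ∈ closedBall x₀ a) ∧
      ∀ t ∈ Icc (0 : ℝ) 1, HasDerivWithinAt G (f (G t)) (Icc 0 1) t := by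
  have hf : IsPicardLindelof (fun _ => f) (tmin := 0) (tmax := 1) ⟨0, by simp⟩ x₀ a 0 a K :=
    .of_time_independent hb hl (by simp)
  have hx : x₀ ∈ closedBall x₀ (0 : NNReal) := by simp
  obtain ⟨α, hα⟩ := ODE.FunSpace.exists_isFixedPt_next hf hx
  refine ⟨α.compProj, ?_, fun t => α.compProj_mem_closedBall hf.mul_max_le, fun t ht => ?_⟩
  · have : α.compProj ((⟨0, by simp⟩ : Icc (0 : ℝ) 1) : ℝ) = x₀ := by
      rw [ODE.FunSpace.compProj_val, ← hα, ODE.FunSpace.next_apply₀]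
    simpa using this
  · refine (ODE.hasDerivWithinAt_picard_Icc (t₀ := 0) (by simp) hf.continuousOn_uncurry
      α.continuous_compProj.continuousOn
      (fun _ _ => α.compProj_mem_closedBall hf.mul_max_le) x₀ ht).congr_of_mem ?_ ht
    intro s hs
    rw [ODE.FunSpace.compProj_of_mem hs]
    conv_lhs => rw [← hα]
    rw [ODE.FunSpace.next_apply]

/-- The Frobenius theorem for the total differential equation `f' = A(f)`, `f 0 = x₀`. The value
`f p` is the value at time `1` of the solution of `G' = A(G) p`, `G 0 = x₀`; the integrability
condition makes `A(f p) v` the derivative of `f` in the direction `v`. -/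
theorem exists_hasFDerivAt_of_commuting {𝕜 E X : Type*} [RCLike 𝕜] [NormedAddCommGroup E]
    [NormedSpace 𝕜 E] [NormedAddCommGroup X] [NormedSpace 𝕜 X] [NormedSpace ℝ X]
    [IsScalarTower ℝ 𝕜 X] [CompleteSpace X] {A : X → E →L[𝕜] X} {x₀ : X}
    (hA : ContDiffAt 𝕜 2 A x₀)
    (hcomm : ∀ᶠ x in 𝓝 x₀, ∀ u v, fderiv 𝕜 A x (A x u) v = fderiv 𝕜 A x (A x v) u) :
    ∃ f : E → X, f 0 = x₀ ∧ ∀ᶠ p in 𝓝 (0 : E), HasFDerivAt f (A (f p)) p := by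
  -- uniform bounds on a small ball
  have hdiff : ∀ᶠ x in 𝓝 x₀, ContDiffAt 𝕜 2 A x := hA.eventually (by simp)
  have hD : ContDiffAt 𝕜 1 (fderiv 𝕜 A) x₀ := hA.fderiv_right (by norm_num)
  obtain ⟨M, s, hs, hM⟩ := hD.exists_lipschitzOnWith
  have hcA : ∀ᶠ x in 𝓝 x₀, ‖A x‖ < ‖A x₀‖ + 1 :=
    hA.continuousAt.norm.eventually_lt_const (lt_add_one _)
  have hcD : ∀ᶠ x in 𝓝 x₀, ‖fderiv 𝕜 A x‖ < ‖fderiv 𝕜 A x₀‖ + 1 :=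
    ((continuous_norm (E := X →L[𝕜] E →L[𝕜] X)).continuousAt.comp
      hD.continuousAt).eventually_lt_const (lt_add_one _)
  obtain ⟨a', ha', hball⟩ := Metric.mem_nhds_iff.1
    (inter_mem hs (hdiff.and (hcA.and (hcD.and hcomm))))
  obtain ⟨a, ha0, haa⟩ : ∃ a : NNReal, 0 < a ∧ (a : ℝ) < a' :=
    ⟨(a' / 2).toNNReal, by simpa using ha', by
      rw [Real.coe_toNNReal _ (half_pos ha').le]; exact half_lt_self ha'⟩
  set B := closedBall x₀ (a : ℝ) with hB
  have hBs : B ⊆ ball x₀ a' := closedBall_subset_ball haa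
  set L : ℝ := ‖A x₀‖ + 1 with hL
  set K : ℝ := ‖fderiv 𝕜 A x₀‖ + 1 with hK
  have hL0 : 0 < L := by positivity
  have hK0 : 0 < K := by positivity
  have hAL : ∀ x ∈ B, ‖A x‖ ≤ L := fun x hx => (hball (hBs hx)).2.2.1.le
  have hAK : ∀ x ∈ B, ‖fderiv 𝕜 A x‖ ≤ K := fun x hx => (hball (hBs hx)).2.2.2.1.le
  have hAd : ∀ x ∈ B, DifferentiableAt 𝕜 A x :=
    fun x hx => (hball (hBs hx)).2.1.differentiableAt (by simp)
  have hAc : ∀ x ∈ B, ∀ u v, fderiv 𝕜 A x (A x u) v = fderiv 𝕜 A x (A x v) u :=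
    fun x hx => (hball (hBs hx)).2.2.2.2
  have hconv : Convex ℝ B := convex_closedBall _ _
  have hlip : ∀ x ∈ B, ∀ y ∈ B, ‖A y - A x‖ ≤ K * ‖y - x‖ := fun x hx y hy =>
    hconv.norm_image_sub_le_of_norm_fderiv_le hAd hAK hx hy
  have hquad : ∀ x ∈ B, ∀ y ∈ B, ‖A y - A x - fderiv 𝕜 A x (y - x)‖ ≤ M * ‖y - x‖ ^ 2 := by
    intro x hx y hy
    have hseg : segment ℝ x y ⊆ B := hconv.segment_subset hx hy
    have := (convex_segment x y).norm_image_sub_le_of_norm_hasFDerivWithin_le' (𝕜 := 𝕜) (f := A)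
      (f' := fderiv 𝕜 A) (φ := fderiv 𝕜 A x) (C := M * ‖y - x‖)
      (fun z hz => (hAd z (hseg hz)).hasFDerivAt.hasFDerivWithinAt)
      (fun z hz => by
        refine (hM.norm_sub_le (hball (hBs (hseg hz))).1 (hball (hBs hx)).1).trans ?_
        gcongr
        exact norm_sub_le_of_mem_segment hz)
      (left_mem_segment ℝ x y) (right_mem_segment ℝ x y)
    refine this.trans (le_of_eq ?_)
    ring
  -- the radial solutions
  obtain ⟨ρ, hρ0, hρL, hρK⟩ : ∃ ρ : ℝ, 0 < ρ ∧ L * ρ ≤ a ∧ K * ρ ≤ 1 := by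
    have ha0' : (0 : ℝ) < a := ha0
    refine ⟨min (a / L) (1 / K), by positivity, ?_, ?_⟩
    · calc L * min (a / L) (1 / K) ≤ L * (a / L) := by gcongr; exact min_le_left _ _
        _ = a := by field_simp
    · calc K * min (a / L) (1 / K) ≤ K * (1 / K) := by gcongr; exact min_le_right _ _
        _ = 1 := by field_simp
  have hsol : ∀ p : E, ∃ G : ℝ → X, ‖p‖ ≤ ρ → G 0 = x₀ ∧ (∀ t, G t ∈ B) ∧
      ∀ t ∈ Icc (0 : ℝ) 1, HasDerivWithinAt G (A (G t) p) (Icc 0 1) t := by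
    intro p
    by_cases hp : ‖p‖ ≤ ρ
    · obtain ⟨G, hG⟩ := exists_solution_mem_closedBall (f := fun x => A x p) (x₀ := x₀) (a := a)
        (K := 1) (LipschitzOnWith.of_dist_le_mul fun x hx y hy => by
          rw [dist_eq_norm, dist_eq_norm, ← sub_apply]
          calc ‖(A x - A y) p‖ ≤ ‖A x - A y‖ * ‖p‖ := (A x - A y).le_opNorm p
            _ ≤ (K * ‖x - y‖) * ρ := by gcongr; exact hlip y hy x hx
            _ = (K * ρ) * ‖x - y‖ := by ring
            _ ≤ _ := by push_cast; gcongr)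
        (fun x hx => ((A x).le_opNorm p).trans
          ((mul_le_mul (hAL x hx) hp (norm_nonneg _) hL0.le).trans hρL))
      exact ⟨G, fun _ => hG⟩
    · exact ⟨fun _ => x₀, fun h => absurd h hp⟩
  choose G hG using hsol
  have hG0 : G 0 1 = x₀ := by
    have h := hG 0 (by simpa using hρ0.le)
    have := norm_le_two_mul_of_norm_deriv_le (R := fun t => G 0 t - x₀) (R' := fun _ => 0) (ε := 0)
      (fun t ht => by simpa using (h.2.2 t ht).sub_const x₀) (by simp [h.1]) le_rfl (by simp)
      1 (by simp)
    simpa [sub_eq_zero] using this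
  refine ⟨fun p => G p 1, hG0, ?_⟩
  -- comparison of two radial solutions
  have hclose : ∀ p q : E, ‖p‖ ≤ ρ → ‖q‖ ≤ ρ → ∀ t ∈ Icc (0 : ℝ) 1,
      ‖G q t - G p t‖ ≤ 2 * (L * ‖q - p‖) := by
    intro p q hp hq
    refine norm_le_two_mul_of_norm_deriv_le (R := fun t => G q t - G p t)
      (R' := fun t => A (G q t) q - A (G p t) p)
      (fun t ht => ((hG q hq).2.2 t ht).sub ((hG p hp).2.2 t ht))
      (by simp [(hG p hp).1, (hG q hq).1]) (by positivity) (fun t ht => ?_)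
    have e : A (G q t) q - A (G p t) p = (A (G q t) - A (G p t)) p + A (G q t) (q - p) := by
      simp
    rw [e]
    refine (norm_add_le _ _).trans (add_le_add ?_ ?_)
    · calc _ ≤ ‖A (G q t) - A (G p t)‖ * ‖p‖ := ContinuousLinearMap.le_opNorm _ _
        _ ≤ (K * ‖G q t - G p t‖) * ρ := by
          gcongr
          exact hlip _ ((hG p hp).2.1 t) _ ((hG q hq).2.1 t)
        _ = (K * ρ) * ‖G q t - G p t‖ := by ring
        _ ≤ 1 * ‖G q t - G p t‖ := by gcongr
        _ = _ := one_mul _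
    · exact (ContinuousLinearMap.le_opNorm _ _).trans
        (by gcongr; exact hAL _ ((hG q hq).2.1 t))
  have hmain : ∀ p q : E, ‖p‖ ≤ ρ → ‖q‖ ≤ ρ →
      ‖G q 1 - G p 1 - A (G p 1) (q - p)‖ ≤
        2 * ((K * (2 * L) + M * (2 * L) ^ 2 * ρ) * ‖q - p‖ ^ 2) := by
    intro p q hp hq
    have h1 : (1 : ℝ) ∈ Icc (0 : ℝ) 1 := by simp
    obtain ⟨v, hv⟩ : ∃ v, v = q - p := ⟨_, rfl⟩
    rw [← hv]
    have hR := norm_le_two_mul_of_norm_deriv_le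
      (R := fun t => G q t - G p t - t • A (G p t) v)
      (R' := fun t => A (G q t) q - A (G p t) p -
        (t • fderiv 𝕜 A (G p t) (A (G p t) p) v + A (G p t) v))
      (ε := (K * (2 * L) + M * (2 * L) ^ 2 * ρ) * ‖v‖ ^ 2)
      (fun t ht => ?_) (by simp [(hG p hp).1, (hG q hq).1]) (by positivity) (fun t ht => ?_) 1 h1
    · simpa using hR
    · have hF : HasFDerivAt (𝕜 := 𝕜) (fun x => A x v) ((fderiv 𝕜 A (G p t)).flip v) (G p t) := by
        have := (hAd _ ((hG p hp).2.1 t)).hasFDerivAt.clm_apply (hasFDerivAt_const v (G p t))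
        simpa using this
      have hF' := (hF.restrictScalars ℝ).comp_hasDerivWithinAt t ((hG p hp).2.2 t ht)
      refine HasDerivWithinAt.congr_deriv ((((hG q hq).2.2 t ht).sub ((hG p hp).2.2 t ht)).sub
        ((hasDerivWithinAt_id t (Icc 0 1)).smul hF')) ?_
      simp
    · set x := G p t with hx
      set y := G q t with hy
      have hxB : x ∈ B := (hG p hp).2.1 t
      have hyB : y ∈ B := (hG q hq).2.1 t
      have hΔ : ‖y - x‖ ≤ 2 * (L * ‖v‖) := hv ▸ hclose p q hp hq t ht
      have hq' : q = p + v := by simp [hv]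
      -- the commutation hypothesis cancels the terms linear in `v`
      have e : A y q - A x p - (t • fderiv 𝕜 A x (A x p) v + A x v) =
          (A y - A x) v + (A y - A x - fderiv 𝕜 A x (y - x)) p +
            fderiv 𝕜 A x (y - x - t • A x v) p := by
        have h2 : fderiv 𝕜 A x (t • A x v) p = t • fderiv 𝕜 A x (A x p) v := by
          rw [← hAc x hxB, ← algebraMap_smul 𝕜 t (A x v), map_smul, smul_apply,
            algebraMap_smul]
        have h3 : fderiv 𝕜 A x (y - x - t • A x v) p =
            fderiv 𝕜 A x (y - x) p - t • fderiv 𝕜 A x (A x p) v := by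
          rw [map_sub (fderiv 𝕜 A x) (y - x) (t • A x v), sub_apply, h2]
        rw [h3, hq']
        simp only [map_add, sub_apply, map_sub]
        abel
      rw [e]
      have t1 : ‖(A y - A x) v‖ ≤ K * (2 * L) * ‖v‖ ^ 2 := by
        calc _ ≤ ‖A y - A x‖ * ‖v‖ := ContinuousLinearMap.le_opNorm _ _
          _ ≤ (K * (2 * (L * ‖v‖))) * ‖v‖ := by
            gcongr
            exact (hlip x hxB y hyB).trans (by gcongr)
          _ = _ := by ring
      have t2 : ‖(A y - A x - fderiv 𝕜 A x (y - x)) p‖ ≤ M * (2 * L) ^ 2 * ρ * ‖v‖ ^ 2 := by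
        calc _ ≤ ‖A y - A x - fderiv 𝕜 A x (y - x)‖ * ‖p‖ := ContinuousLinearMap.le_opNorm _ _
          _ ≤ (M * (2 * (L * ‖v‖)) ^ 2) * ρ := by
            gcongr
            exact (hquad x hxB y hyB).trans (by gcongr)
          _ = _ := by ring
      have t3 : ‖fderiv 𝕜 A x (y - x - t • A x v) p‖ ≤ ‖y - x - t • A x v‖ := by
        calc _ ≤ ‖fderiv 𝕜 A x (y - x - t • A x v)‖ * ‖p‖ := ContinuousLinearMap.le_opNorm _ _
          _ ≤ (K * ‖y - x - t • A x v‖) * ρ := by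
            gcongr
            exact (ContinuousLinearMap.le_opNorm _ _).trans (by gcongr; exact hAK x hxB)
          _ = (K * ρ) * ‖y - x - t • A x v‖ := by ring
          _ ≤ 1 * ‖y - x - t • A x v‖ := by gcongr
          _ = _ := one_mul _
      calc _ ≤ K * (2 * L) * ‖v‖ ^ 2 + M * (2 * L) ^ 2 * ρ * ‖v‖ ^ 2 + ‖y - x - t • A x v‖ :=
            (norm_add_le _ _).trans (add_le_add ((norm_add_le _ _).trans (add_le_add t1 t2)) t3)
        _ = _ := by ring
  filter_upwards [ball_mem_nhds (0 : E) hρ0] with p hp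
  have hp' : ‖p‖ < ρ := by simpa using hp
  refine .of_isLittleO ?_
  refine Asymptotics.IsBigO.trans_isLittleO (g := fun q => ‖q - p‖ ^ 2) ?_ ?_
  · refine .of_bound (2 * (K * (2 * L) + M * (2 * L) ^ 2 * ρ)) ?_
    filter_upwards [isOpen_ball.mem_nhds hp] with q hq
    have hq' : ‖q‖ < ρ := by simpa using hq
    refine (hmain p q hp'.le hq'.le).trans (le_of_eq ?_)
    rw [norm_pow, norm_norm]
    ring
  · have : Tendsto (fun q : E => ‖q - p‖) (𝓝 p) (𝓝 0) := by
      have : Continuous (fun q : E => ‖q - p‖) := by fun_prop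
      simpa using this.tendsto p
    have h1 : (fun q : E => ‖q - p‖) =o[𝓝 p] (fun _ => (1 : ℝ)) :=
      (Asymptotics.isLittleO_one_iff ℝ).2 this
    have h2 := h1.mul_isBigO (Asymptotics.isBigO_refl (fun q : E => ‖q - p‖) (𝓝 p))
    exact (Asymptotics.isLittleO_norm_right.1 (h2.congr (fun q => by ring) (fun q => by ring)))

/-- Solutions of a smooth total differential equation are smooth. -/
theorem contDiffOn_infty_of_hasFDerivAt {𝕜 E X : Type*} [RCLike 𝕜] [NormedAddCommGroup E]
    [NormedSpace 𝕜 E] [NormedAddCommGroup X] [NormedSpace 𝕜 X] {A : X → E →L[𝕜] X} {f : E → X}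
    {U : Set E} {S : Set X} (hU : IsOpen U) (hA : ContDiffOn 𝕜 ∞ A S) (hmaps : MapsTo f U S)
    (hf : ∀ p ∈ U, HasFDerivAt f (A (f p)) p) : ContDiffOn 𝕜 ∞ f U := by
  rw [contDiffOn_infty]
  intro n
  induction n with
  | zero =>
    exact contDiffOn_zero.2 fun p hp => (hf p hp).continuousAt.continuousWithinAt
  | succ n ih =>
    have : ((n + 1 : ℕ) : WithTop ℕ∞) = (n : WithTop ℕ∞) + 1 := by simp
    rw [this, contDiffOn_succ_iff_fderiv_of_isOpen hU]
    refine ⟨fun p hp => (hf p hp).differentiableAt.differentiableWithinAt, by simp, ?_⟩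
    refine ((hA.of_le (by exact_mod_cast le_top)).comp ih hmaps).congr fun p hp => ?_
    exact (hf p hp).fderiv

/-! ### Scalar linear equations on a ball -/

section ball

variable {𝕜 : Type*} [RCLike 𝕜] {s₀ : 𝕜} {r : ℝ}

/-- Over `ℂ` the hypothesis of differentiability is the closedness that the existence of a primitive
requires; over `ℝ` it is stronger than needed. -/
theorem exists_primitive_on_ball {m : 𝕜 → 𝕜} (hm : DifferentiableOn 𝕜 m (ball s₀ r)) :
    ∃ M : 𝕜 → 𝕜, M s₀ = 0 ∧ ∀ s ∈ ball s₀ r, HasDerivAt M (m s) s := by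
  have hω : ∀ x ∈ ball s₀ r, HasFDerivAt (𝕜 := 𝕜)
      (fun s => ContinuousLinearMap.toSpanSingleton 𝕜 (m s))
      ((ContinuousLinearMap.toSpanSingletonCLE (𝕜 := 𝕜) (E := 𝕜)).toContinuousLinearMap.comp
        (ContinuousLinearMap.toSpanSingleton 𝕜 (deriv m x))) x := by
    intro x hx
    exact (ContinuousLinearMap.toSpanSingletonCLE (𝕜 := 𝕜) (E := 𝕜)).hasFDerivAt.comp x
      (hm.differentiableAt (isOpen_ball.mem_nhds hx)).hasDerivAt.hasFDerivAt
  obtain ⟨M, hM⟩ := (convex_ball s₀ r)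
    |>.exists_forall_hasFDerivWithinAt_of_hasFDerivWithinAt_symmetric (𝕜 := 𝕜)
    (fun x hx => ((hω x hx).restrictScalars ℝ).hasFDerivWithinAt)
    (fun a _ x _ y _ => by simp; ring)
  refine ⟨fun s => M s - M s₀, by simp, fun s hs => ?_⟩
  have := ((hM s hs).hasFDerivAt (isOpen_ball.mem_nhds hs)).hasDerivAt.sub_const (M s₀)
  simpa using this

/-- The solution is the exponential of a primitive, hence it has no zero. -/
theorem exists_solution_linear {m : 𝕜 → 𝕜} (hm : DifferentiableOn 𝕜 m (ball s₀ r)) :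
    ∃ g : 𝕜 → 𝕜, g s₀ = 1 ∧ (∀ s, g s ≠ 0) ∧ ∀ s ∈ ball s₀ r, HasDerivAt g (g s * m s) s := by
  obtain ⟨M, hM0, hM⟩ := exists_primitive_on_ball hm
  refine ⟨fun s => NormedSpace.exp (M s), by simp [hM0], fun s => ?_, fun s hs => ?_⟩
  · intro h
    have : NormedSpace.exp (M s) * NormedSpace.exp (-M s) = (1 : 𝕜) := by
      rw [← NormedSpace.exp_add_of_commute (Commute.all _ _), add_neg_cancel, NormedSpace.exp_zero]
    simp [h] at this
  · exact (hasDerivAt_exp (𝕂 := 𝕜) (x := M s)).comp s (hM s hs)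

/-- Variation of constants. -/
theorem exists_solution_affine {m n : 𝕜 → 𝕜} (hm : DifferentiableOn 𝕜 m (ball s₀ r))
    (hn : DifferentiableOn 𝕜 n (ball s₀ r)) :
    ∃ g : 𝕜 → 𝕜, g s₀ = 0 ∧ ∀ s ∈ ball s₀ r, HasDerivAt g (g s * m s + n s) s := by
  obtain ⟨E, -, hE, hE'⟩ := exists_solution_linear hm
  obtain ⟨Q, hQ0, hQ⟩ := exists_primitive_on_ball (m := fun s => n s / E s)
    (hn.div (fun s hs => (hE' s hs).differentiableAt.differentiableWithinAt) fun s _ => hE s)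
  refine ⟨fun s => E s * Q s, by simp [hQ0], fun s hs => ?_⟩
  refine ((hE' s hs).mul (hQ s hs)).congr_deriv ?_
  have := hE s
  field_simp

theorem eqOn_zero_of_hasDerivAt_mul {m g : 𝕜 → 𝕜} (hm : DifferentiableOn 𝕜 m (ball s₀ r))
    (hg : ∀ s ∈ ball s₀ r, HasDerivAt g (g s * m s) s) (h0 : g s₀ = 0) :
    ∀ s ∈ ball s₀ r, g s = 0 := by
  intro s hs
  obtain ⟨E, -, hE, hE'⟩ := exists_solution_linear hm
  have hq : ∀ s ∈ ball s₀ r, HasDerivAt (fun s => g s / E s) 0 s := by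
    intro s hs
    refine ((hg s hs).div (hE' s hs) (hE s)).congr_deriv ?_
    ring_nf
  have hs₀ : s₀ ∈ ball s₀ r := mem_ball_self (pos_of_mem_ball hs)
  have := (convex_ball s₀ r).is_const_of_fderivWithin_eq_zero (𝕜 := 𝕜)
    (f := fun s => g s / E s)
    (fun s hs => (hq s hs).differentiableAt.differentiableWithinAt)
    (fun s hs => by
      rw [fderivWithin_of_isOpen isOpen_ball hs]
      ext
      simp [(hq s hs).deriv]) hs hs₀
  simpa [h0, hE s] using this

end ball

/-! ### Local diffeomorphisms and lines of the plane -/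

theorem isLocalDiffeomorphOn_of_fderiv_injective {𝕜 : Type*} [RCLike 𝕜] {U : Set (Plane 𝕜)}
    {φ : Plane 𝕜 → Plane 𝕜} (hU : IsOpen U) (hφ : ContDiffOn 𝕜 ∞ φ U)
    (hinj : ∀ p ∈ U, ∀ v, fderiv 𝕜 φ p v = 0 → v = 0) :
    IsLocalDiffeomorphOn 𝓘(𝕜, Plane 𝕜) 𝓘(𝕜, Plane 𝕜) ∞ φ U := by
  rintro ⟨p, hp⟩
  have hcd : ∀ q ∈ U, ContDiffAt 𝕜 ∞ φ q := fun q hq => hφ.contDiffAt (hU.mem_nhds hq)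
  have hequiv : ∀ q ∈ U, ∃ e : Plane 𝕜 ≃L[𝕜] Plane 𝕜,
      HasFDerivAt φ (e : Plane 𝕜 →L[𝕜] Plane 𝕜) q := by
    intro q hq
    have hi : Function.Injective (fderiv 𝕜 φ q : Plane 𝕜 →ₗ[𝕜] Plane 𝕜) := by
      rw [← LinearMap.ker_eq_bot, LinearMap.ker_eq_bot']
      exact hinj q hq
    refine ⟨(LinearEquiv.ofInjectiveEndo _ hi).toContinuousLinearEquiv, ?_⟩
    refine ((hcd q hq).differentiableAt (by simp)).hasFDerivAt.congr_fderiv ?_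
    ext <;> rfl
  obtain ⟨e, he⟩ := hequiv p hp
  set Φ := (hcd p hp).toOpenPartialHomeomorph φ he (by simp) with hΦ
  have hco : ∀ q, Φ q = φ q := fun q => rfl
  set Ψ := Φ.restrOpen U hU with hΨ
  have hsrc : Ψ.source = Φ.source ∩ U := by simp [hΨ]
  refine ⟨{ toPartialEquiv := Ψ.toPartialEquiv
            open_source := Ψ.open_source
            open_target := Ψ.open_target
            contMDiffOn_toFun := ?_
            contMDiffOn_invFun := ?_ }, ?_, ?_⟩
  · refine contMDiffOn_iff_contDiffOn.2 ((hφ.congr fun q _ => ?_).mono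
      (s := U) (fun q hq => (hsrc ▸ hq : q ∈ Φ.source ∩ U).2))
    rfl
  · refine contMDiffOn_iff_contDiffOn.2 fun y hy => ?_
    have hm : Ψ.symm y ∈ Φ.source ∩ U := hsrc ▸ Ψ.map_target hy
    obtain ⟨e', he'⟩ := hequiv _ hm.2
    exact (Ψ.contDiffAt_symm hy he' (hcd _ hm.2)).contDiffWithinAt
  · rw [show _ = Φ.source ∩ U from hsrc]
    exact ⟨(hcd p hp).mem_toOpenPartialHomeomorph_source he (by simp), hp⟩
  · intro q _
    rfl

theorem fderiv_injective_of_isLocalDiffeomorphOn {𝕜 : Type*} [RCLike 𝕜] {U : Set (Plane 𝕜)}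
    {φ : Plane 𝕜 → Plane 𝕜}
    (hφ : IsLocalDiffeomorphOn 𝓘(𝕜, Plane 𝕜) 𝓘(𝕜, Plane 𝕜) ∞ φ U) {p : Plane 𝕜} (hp : p ∈ U)
    {v : Plane 𝕜} (hv : fderiv 𝕜 φ p v = 0) : v = 0 := by
  have h := (hφ ⟨p, hp⟩).mfderivToContinuousLinearEquiv_coe (by simp)
  rw [mfderiv_eq_fderiv] at h
  let e := (hφ ⟨p, hp⟩).mfderivToContinuousLinearEquiv (by simp)
  exact e.injective ((DFunLike.congr_fun h v).trans (hv.trans (map_zero e).symm))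

theorem collinear_of_affine_equation {𝕜 : Type*} [RCLike 𝕜] {S : Set (Plane 𝕜)} {a b c : 𝕜}
    (hab : a ≠ 0 ∨ b ≠ 0) (hS : ∀ z ∈ S, a * z.1 + b * z.2 + c = 0) : Collinear 𝕜 S := by
  rcases S.eq_empty_or_nonempty with rfl | ⟨z₀, hz₀⟩
  · exact collinear_empty 𝕜 _
  rw [collinear_iff_of_mem hz₀]
  refine ⟨(-b, a), fun z hz => ?_⟩
  have h1 := hS z hz
  have h0 := hS z₀ hz₀
  rcases hab with ha | hb
  · refine ⟨(z.2 - z₀.2) / a, ?_⟩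
    ext
    · simp only [vadd_eq_add, Prod.fst_add, Prod.smul_fst, smul_eq_mul]
      field_simp
      linear_combination h1 - h0
    · simp only [vadd_eq_add, Prod.snd_add, Prod.smul_snd, smul_eq_mul]
      field_simp
      ring
  · refine ⟨-(z.1 - z₀.1) / b, ?_⟩
    ext
    · simp only [vadd_eq_add, Prod.fst_add, Prod.smul_fst, smul_eq_mul]
      field_simp
      ring
    · simp only [vadd_eq_add, Prod.snd_add, Prod.smul_snd, smul_eq_mul]
      field_simp
      linear_combination h1 - h0

theorem exists_affine_equation_of_collinear {𝕜 : Type*} [RCLike 𝕜] {S : Set (Plane 𝕜)}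
    (hS : Collinear 𝕜 S) : ∃ a b c : 𝕜, (a ≠ 0 ∨ b ≠ 0) ∧ ∀ z ∈ S, a * z.1 + b * z.2 + c = 0 := by
  obtain ⟨z₀, v, hv⟩ := (collinear_iff_exists_forall_eq_smul_vadd S).1 hS
  by_cases h : v = 0
  · refine ⟨1, 0, -z₀.1, by simp, fun z hz => ?_⟩
    obtain ⟨t, rfl⟩ := hv z hz
    simp [h]
  · refine ⟨v.2, -v.1, v.1 * z₀.2 - v.2 * z₀.1, ?_, fun z hz => ?_⟩
    · by_contra! h'
      exact h (Prod.ext (by simpa using h'.2) h'.1)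
    · obtain ⟨t, rfl⟩ := hv z hz
      simp only [vadd_eq_add, Prod.fst_add, Prod.smul_fst, smul_eq_mul, Prod.snd_add,
        Prod.smul_snd]
      ring

variable {𝕜 : Type*} [RCLike 𝕜] {V : Set (Plane 𝕜)} {ω₁ ω₂ : OneForm 𝕜}

/-! ### The frame dual to the web -/

/-- The vector field `e₁` with `ω₁ e₁ = 0` and `ω₂ e₁ = -1`, for which `f₁ = df e₁`. It is tangent
to the leaves of the first foliation. -/
def frame₁ (ω₁ ω₂ : OneForm 𝕜) (p : Plane 𝕜) : Plane 𝕜 :=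
  (wedge ω₁ ω₂ p (1, 0) (0, 1))⁻¹ • (ω₁ p (0, 1), -ω₁ p (1, 0))

/-- The vector field `e₂` with `ω₁ e₂ = 1` and `ω₂ e₂ = 0`, for which `f₂ = df e₂`. It is tangent
to the leaves of the second foliation. -/
def frame₂ (ω₁ ω₂ : OneForm 𝕜) (p : Plane 𝕜) : Plane 𝕜 :=
  (wedge ω₁ ω₂ p (1, 0) (0, 1))⁻¹ • (ω₂ p (0, 1), -ω₂ p (1, 0))

theorem clm_apply_eq (L : Plane 𝕜 →L[𝕜] 𝕜) (u : Plane 𝕜) :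
    L u = u.1 * L (1, 0) + u.2 * L (0, 1) := by
  have hu : u = u.1 • ((1, 0) : Plane 𝕜) + u.2 • ((0, 1) : Plane 𝕜) := by ext <;> simp
  conv_lhs => rw [hu, map_add, map_smul, map_smul, smul_eq_mul, smul_eq_mul]

theorem D₁_eq_fderiv_frame (f : Plane 𝕜 → 𝕜) (p : Plane 𝕜) :
    D₁ ω₁ ω₂ f p = fderiv 𝕜 f p (frame₁ ω₁ ω₂ p) := by
  rw [frame₁, map_smul, clm_apply_eq, D₁, coeff]
  simp only [wedge, smul_eq_mul]
  ring

theorem D₂_eq_fderiv_frame (f : Plane 𝕜 → 𝕜) (p : Plane 𝕜) :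
    D₂ ω₁ ω₂ f p = fderiv 𝕜 f p (frame₂ ω₁ ω₂ p) := by
  rw [frame₂, map_smul, clm_apply_eq, D₂, coeff]
  simp only [wedge, smul_eq_mul]
  ring

section frame

variable {p : Plane 𝕜}

theorem form₁_frame₁ : ω₁ p (frame₁ ω₁ ω₂ p) = 0 := by
  rw [frame₁, map_smul, clm_apply_eq]
  simp only [smul_eq_mul]
  ring

theorem form₂_frame₂ : ω₂ p (frame₂ ω₁ ω₂ p) = 0 := by
  rw [frame₂, map_smul, clm_apply_eq]
  simp only [smul_eq_mul]
  ring

theorem form₂_frame₁ (h : wedge ω₁ ω₂ p (1, 0) (0, 1) ≠ 0) :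
    ω₂ p (frame₁ ω₁ ω₂ p) = -1 := by
  rw [frame₁, map_smul, clm_apply_eq, smul_eq_mul, inv_mul_eq_iff_eq_mul₀ h]
  simp only [wedge]
  ring

theorem form₁_frame₂ (h : wedge ω₁ ω₂ p (1, 0) (0, 1) ≠ 0) :
    ω₁ p (frame₂ ω₁ ω₂ p) = 1 := by
  rw [frame₂, map_smul, clm_apply_eq, smul_eq_mul, inv_mul_eq_iff_eq_mul₀ h]
  simp only [wedge]
  ring

theorem eq_frame_combination (h : wedge ω₁ ω₂ p (1, 0) (0, 1) ≠ 0) (v : Plane 𝕜) :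
    v = ω₁ p v • frame₂ ω₁ ω₂ p - ω₂ p v • frame₁ ω₁ ω₂ p := by
  rw [clm_apply_eq (ω₁ p) v, clm_apply_eq (ω₂ p) v, frame₁, frame₂]
  ext
  · simp only [Prod.fst_sub, Prod.smul_fst, smul_eq_mul]
    field_simp
    simp only [wedge]
    ring
  · simp only [Prod.snd_sub, Prod.smul_snd, smul_eq_mul]
    field_simp
    simp only [wedge]
    ring

end frame

/-- `f` is differentiable at `p`, with `f₁ = a` and `f₂ = b` there. -/
structure HasFrameDerivAt (ω₁ ω₂ : OneForm 𝕜) (f : Plane 𝕜 → 𝕜) (a b : 𝕜) (p : Plane 𝕜) :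
    Prop where
  differentiableAt : DifferentiableAt 𝕜 f p
  D₁_eq : D₁ ω₁ ω₂ f p = a
  D₂_eq : D₂ ω₁ ω₂ f p = b

namespace HasFrameDerivAt

variable {f g : Plane 𝕜 → 𝕜} {a b a' b' : 𝕜} {p : Plane 𝕜}

theorem of_differentiableAt (hf : DifferentiableAt 𝕜 f p) :
    HasFrameDerivAt ω₁ ω₂ f (D₁ ω₁ ω₂ f p) (D₂ ω₁ ω₂ f p) p :=
  ⟨hf, rfl, rfl⟩

theorem of_hasFDerivAt {f' : Plane 𝕜 →L[𝕜] 𝕜} (hf : HasFDerivAt f f' p) :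
    HasFrameDerivAt ω₁ ω₂ f (f' (frame₁ ω₁ ω₂ p)) (f' (frame₂ ω₁ ω₂ p)) p :=
  ⟨hf.differentiableAt, by rw [D₁_eq_fderiv_frame, hf.fderiv],
    by rw [D₂_eq_fderiv_frame, hf.fderiv]⟩

theorem congr_deriv (hf : HasFrameDerivAt ω₁ ω₂ f a b p) (ha : a = a') (hb : b = b') :
    HasFrameDerivAt ω₁ ω₂ f a' b' p :=
  ha ▸ hb ▸ hf

theorem congr_of_eventuallyEq (hf : HasFrameDerivAt ω₁ ω₂ f a b p) (h : g =ᶠ[𝓝 p] f) :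
    HasFrameDerivAt ω₁ ω₂ g a b p :=
  ⟨hf.differentiableAt.congr_of_eventuallyEq h,
    by rw [D₁_eq_fderiv_frame, h.fderiv_eq, ← D₁_eq_fderiv_frame, hf.D₁_eq],
    by rw [D₂_eq_fderiv_frame, h.fderiv_eq, ← D₂_eq_fderiv_frame, hf.D₂_eq]⟩

theorem const (k : 𝕜) : HasFrameDerivAt ω₁ ω₂ (fun _ => k) 0 0 p :=
  (of_hasFDerivAt (hasFDerivAt_const k p)).congr_deriv (by simp) (by simp)

theorem add (hf : HasFrameDerivAt ω₁ ω₂ f a b p) (hg : HasFrameDerivAt ω₁ ω₂ g a' b' p) :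
    HasFrameDerivAt ω₁ ω₂ (fun x => f x + g x) (a + a') (b + b') p := by
  refine (of_hasFDerivAt (hf.1.hasFDerivAt.add hg.1.hasFDerivAt)).congr_deriv ?_ ?_
  · rw [← hf.D₁_eq, ← hg.D₁_eq, D₁_eq_fderiv_frame, D₁_eq_fderiv_frame, add_apply]
  · rw [← hf.D₂_eq, ← hg.D₂_eq, D₂_eq_fderiv_frame, D₂_eq_fderiv_frame, add_apply]

theorem mul (hf : HasFrameDerivAt ω₁ ω₂ f a b p) (hg : HasFrameDerivAt ω₁ ω₂ g a' b' p) :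
    HasFrameDerivAt ω₁ ω₂ (fun x => f x * g x) (f p * a' + g p * a) (f p * b' + g p * b) p := by
  refine (of_hasFDerivAt (hf.1.hasFDerivAt.mul hg.1.hasFDerivAt)).congr_deriv ?_ ?_
  · rw [← hf.D₁_eq, ← hg.D₁_eq, D₁_eq_fderiv_frame, D₁_eq_fderiv_frame]
    simp
  · rw [← hf.D₂_eq, ← hg.D₂_eq, D₂_eq_fderiv_frame, D₂_eq_fderiv_frame]
    simp

theorem const_mul (k : 𝕜) (hf : HasFrameDerivAt ω₁ ω₂ f a b p) :
    HasFrameDerivAt ω₁ ω₂ (fun x => k * f x) (k * a) (k * b) p :=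
  ((const k).mul hf).congr_deriv (by simp) (by simp)

theorem neg (hf : HasFrameDerivAt ω₁ ω₂ f a b p) :
    HasFrameDerivAt ω₁ ω₂ (fun x => -f x) (-a) (-b) p := by
  simpa using hf.const_mul (-1)

theorem sub (hf : HasFrameDerivAt ω₁ ω₂ f a b p) (hg : HasFrameDerivAt ω₁ ω₂ g a' b' p) :
    HasFrameDerivAt ω₁ ω₂ (fun x => f x - g x) (a - a') (b - b') p := by
  simpa [sub_eq_add_neg] using hf.add hg.neg

theorem inv (hf : HasFrameDerivAt ω₁ ω₂ f a b p) (h0 : f p ≠ 0) :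
    HasFrameDerivAt ω₁ ω₂ (fun x => (f x)⁻¹) (-a / f p ^ 2) (-b / f p ^ 2) p := by
  have h := (hasDerivAt_inv h0).hasFDerivAt.comp p hf.1.hasFDerivAt
  refine (of_hasFDerivAt h).congr_deriv ?_ ?_
  · rw [← hf.D₁_eq, D₁_eq_fderiv_frame]
    simp [div_eq_mul_inv]
  · rw [← hf.D₂_eq, D₂_eq_fderiv_frame]
    simp [div_eq_mul_inv]

end HasFrameDerivAt

theorem IsNormalizedWeb.mono {W : Set (Plane 𝕜)} (hω : IsNormalizedWeb V ω₁ ω₂) (hW : W ⊆ V) :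
    IsNormalizedWeb W ω₁ ω₂ :=
  ⟨hω.smooth₁.mono hW, hω.smooth₂.mono hW, fun p hp => hω.independent p (hW hp),
    fun p hp => hω.curvature p (hW hp)⟩

section smooth

theorem contDiffOn_form_apply {θ : OneForm 𝕜} (hθ : ContDiffOn 𝕜 ∞ θ V) (u : Plane 𝕜) :
    ContDiffOn 𝕜 ∞ (fun p => θ p u) V :=
  hθ.clm_apply contDiffOn_const

theorem contDiffOn_wedge (hω : IsNormalizedWeb V ω₁ ω₂) (u v : Plane 𝕜) :
    ContDiffOn 𝕜 ∞ (fun p => wedge ω₁ ω₂ p u v) V := by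
  have h₁ := fun u => contDiffOn_form_apply hω.smooth₁ u
  have h₂ := fun u => contDiffOn_form_apply hω.smooth₂ u
  exact ((h₁ u).mul (h₂ v)).sub ((h₁ v).mul (h₂ u))

theorem contDiffOn_frame₁ (hω : IsNormalizedWeb V ω₁ ω₂) :
    ContDiffOn 𝕜 ∞ (frame₁ ω₁ ω₂) V := by
  have h₁ := fun u => contDiffOn_form_apply hω.smooth₁ u
  exact ((contDiffOn_wedge hω (1, 0) (0, 1)).inv hω.independent).smul
    ((h₁ _).prodMk (h₁ _).neg)

theorem contDiffOn_frame₂ (hω : IsNormalizedWeb V ω₁ ω₂) :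
    ContDiffOn 𝕜 ∞ (frame₂ ω₁ ω₂) V := by
  have h₂ := fun u => contDiffOn_form_apply hω.smooth₂ u
  exact ((contDiffOn_wedge hω (1, 0) (0, 1)).inv hω.independent).smul
    ((h₂ _).prodMk (h₂ _).neg)

theorem contDiffOn_fderiv {X : Type*} [NormedAddCommGroup X] [NormedSpace 𝕜 X] (hV : IsOpen V)
    {f : Plane 𝕜 → X} (hf : ContDiffOn 𝕜 ∞ f V) : ContDiffOn 𝕜 ∞ (fderiv 𝕜 f) V :=
  ((contDiffOn_infty_iff_fderiv_of_isOpen hV).1 hf).2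

theorem contDiffOn_D₁ (hV : IsOpen V) (hω : IsNormalizedWeb V ω₁ ω₂) {f : Plane 𝕜 → 𝕜}
    (hf : ContDiffOn 𝕜 ∞ f V) : ContDiffOn 𝕜 ∞ (D₁ ω₁ ω₂ f) V :=
  ((contDiffOn_fderiv hV hf).clm_apply (contDiffOn_frame₁ hω)).congr
    fun p _ => D₁_eq_fderiv_frame f p

theorem contDiffOn_D₂ (hV : IsOpen V) (hω : IsNormalizedWeb V ω₁ ω₂) {f : Plane 𝕜 → 𝕜}
    (hf : ContDiffOn 𝕜 ∞ f V) : ContDiffOn 𝕜 ∞ (D₂ ω₁ ω₂ f) V :=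
  ((contDiffOn_fderiv hV hf).clm_apply (contDiffOn_frame₂ hω)).congr
    fun p _ => D₂_eq_fderiv_frame f p

theorem contDiffOn_coeff_extD (hV : IsOpen V) (hω : IsNormalizedWeb V ω₁ ω₂) {θ : OneForm 𝕜}
    (hθ : ContDiffOn 𝕜 ∞ θ V) : ContDiffOn 𝕜 ∞ (coeff ω₁ ω₂ (extD θ)) V := by
  have h := contDiffOn_fderiv hV hθ
  refine ContDiffOn.div ?_ (contDiffOn_wedge hω (1, 0) (0, 1)) hω.independent
  exact ((h.clm_apply contDiffOn_const).clm_apply contDiffOn_const).sub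
    ((h.clm_apply contDiffOn_const).clm_apply contDiffOn_const)

theorem contDiffOn_alpha (hV : IsOpen V) (hω : IsNormalizedWeb V ω₁ ω₂) :
    ContDiffOn 𝕜 ∞ (alpha ω₁ ω₂) V := contDiffOn_coeff_extD hV hω hω.smooth₁

theorem contDiffOn_beta (hV : IsOpen V) (hω : IsNormalizedWeb V ω₁ ω₂) :
    ContDiffOn 𝕜 ∞ (beta ω₁ ω₂) V := contDiffOn_coeff_extD hV hω hω.smooth₂

theorem differentiableAt_of_contDiffOn {X : Type*} [NormedAddCommGroup X] [NormedSpace 𝕜 X]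
    (hV : IsOpen V) {f : Plane 𝕜 → X} (hf : ContDiffOn 𝕜 ∞ f V) {p : Plane 𝕜} (hp : p ∈ V) :
    DifferentiableAt 𝕜 f p :=
  (hf.contDiffAt (hV.mem_nhds hp)).differentiableAt (by simp)

theorem hasFrameDerivAt_of_contDiffOn (hV : IsOpen V) {f : Plane 𝕜 → 𝕜}
    (hf : ContDiffOn 𝕜 ∞ f V) {p : Plane 𝕜} (hp : p ∈ V) :
    HasFrameDerivAt ω₁ ω₂ f (D₁ ω₁ ω₂ f p) (D₂ ω₁ ω₂ f p) p :=
  .of_differentiableAt (differentiableAt_of_contDiffOn hV hf hp)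

end smooth

/-! ### Structure equations -/

theorem extD_eq_coeff_mul_wedge (θ : OneForm 𝕜) {p : Plane 𝕜}
    (h : wedge ω₁ ω₂ p (1, 0) (0, 1) ≠ 0) (u v : Plane 𝕜) :
    extD θ p u v = coeff ω₁ ω₂ (extD θ) p * wedge ω₁ ω₂ p u v := by
  have h1 : extD θ p u v = (u.1 * v.2 - u.2 * v.1) * extD θ p (1, 0) (0, 1) := by
    have hu : u = u.1 • ((1, 0) : Plane 𝕜) + u.2 • ((0, 1) : Plane 𝕜) := by ext <;> simp
    have hv : v = v.1 • ((1, 0) : Plane 𝕜) + v.2 • ((0, 1) : Plane 𝕜) := by ext <;> simp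
    simp only [extD]
    conv_lhs => rw [hu, hv]
    simp only [map_add, map_smul, add_apply, smul_apply, smul_eq_mul]
    ring
  have h2 : wedge ω₁ ω₂ p u v = (u.1 * v.2 - u.2 * v.1) * wedge ω₁ ω₂ p (1, 0) (0, 1) := by
    simp only [wedge]
    rw [clm_apply_eq (ω₁ p) u, clm_apply_eq (ω₁ p) v, clm_apply_eq (ω₂ p) u,
      clm_apply_eq (ω₂ p) v]
    ring
  rw [h1, h2, coeff]
  field_simp

theorem extD_congr {θ η : OneForm 𝕜} {p : Plane 𝕜} (h : θ =ᶠ[𝓝 p] η) : extD θ p = extD η p := by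
  unfold extD
  rw [h.fderiv_eq]

/-- `d(x ω₁ + y ω₂) = (x₁ + α x + y₂ + β y) ω₁ ∧ ω₂`. -/
theorem extD_combination (hV : IsOpen V) (hω : IsNormalizedWeb V ω₁ ω₂) {x y : Plane 𝕜 → 𝕜}
    {x₁ x₂ y₁ y₂ : 𝕜} {p : Plane 𝕜} (hp : p ∈ V) (hx : HasFrameDerivAt ω₁ ω₂ x x₁ x₂ p)
    (hy : HasFrameDerivAt ω₁ ω₂ y y₁ y₂ p) (u v : Plane 𝕜) :
    extD (fun q => x q • ω₁ q + y q • ω₂ q) p u v =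
      (x₁ + alpha ω₁ ω₂ p * x p + y₂ + beta ω₁ ω₂ p * y p) * wedge ω₁ ω₂ p u v := by
  have hw := hω.independent p hp
  have h1 := differentiableAt_of_contDiffOn hV hω.smooth₁ hp
  have h2 := differentiableAt_of_contDiffOn hV hω.smooth₂ hp
  have hα := extD_eq_coeff_mul_wedge ω₁ hw u v
  have hβ := extD_eq_coeff_mul_wedge ω₂ hw u v
  have hd := ((hx.1.hasFDerivAt.smul h1.hasFDerivAt).add
    (hy.1.hasFDerivAt.smul h2.hasFDerivAt)).fderiv
  have key : extD (fun q => x q • ω₁ q + y q • ω₂ q) p u v =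
      x p * extD ω₁ p u v + y p * extD ω₂ p u v
        + (fderiv 𝕜 x p u * ω₁ p v - fderiv 𝕜 x p v * ω₁ p u)
        + (fderiv 𝕜 y p u * ω₂ p v - fderiv 𝕜 y p v * ω₂ p u) := by
    have hfun : (fun q => x q • ω₁ q + y q • ω₂ q) = x • ω₁ + y • ω₂ := rfl
    simp only [extD]
    rw [hfun, hd]
    simp only [add_apply, smul_apply, smul_eq_mul, ContinuousLinearMap.smulRight_apply]
    ring
  rw [key, hα, hβ, fderiv_eq_D ω₁ ω₂ x p u hw, fderiv_eq_D ω₁ ω₂ x p v hw,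
    fderiv_eq_D ω₁ ω₂ y p u hw, fderiv_eq_D ω₁ ω₂ y p v hw, hx.D₁_eq, hx.D₂_eq, hy.D₁_eq,
    hy.D₂_eq, alpha, beta]
  simp only [wedge]
  ring

theorem eq_zero_of_mul_wedge_eq_zero {p : Plane 𝕜} {k : 𝕜} (h : wedge ω₁ ω₂ p (1, 0) (0, 1) ≠ 0)
    (hk : ∀ u v, k * wedge ω₁ ω₂ p u v = 0) : k = 0 :=
  (mul_eq_zero.1 (hk (1, 0) (0, 1))).resolve_right h

/-- The commutation rule `f₂₁ - f₁₂ + α f₂ - β f₁ = 0`, which says that `d(df) = 0`. -/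
theorem D_commutator (hV : IsOpen V) (hω : IsNormalizedWeb V ω₁ ω₂) {f : Plane 𝕜 → 𝕜}
    (hf : ContDiffOn 𝕜 ∞ f V) {p : Plane 𝕜} (hp : p ∈ V) :
    D₁ ω₁ ω₂ (D₂ ω₁ ω₂ f) p = D₂ ω₁ ω₂ (D₁ ω₁ ω₂ f) p
      - alpha ω₁ ω₂ p * D₂ ω₁ ω₂ f p + beta ω₁ ω₂ p * D₁ ω₁ ω₂ f p := by
  have hx := hasFrameDerivAt_of_contDiffOn (ω₁ := ω₁) (ω₂ := ω₂) hV (contDiffOn_D₂ hV hω hf) hp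
  have hy := hasFrameDerivAt_of_contDiffOn (ω₁ := ω₁) (ω₂ := ω₂) hV (contDiffOn_D₁ hV hω hf) hp
  have hgerm : (fderiv 𝕜 f : OneForm 𝕜) =ᶠ[𝓝 p]
      fun q => D₂ ω₁ ω₂ f q • ω₁ q + (-D₁ ω₁ ω₂ f q) • ω₂ q := by
    filter_upwards [hV.mem_nhds hp] with q hq
    ext
    · simp [fderiv_eq_D ω₁ ω₂ f q _ (hω.independent q hq), sub_eq_add_neg]
    · simp [fderiv_eq_D ω₁ ω₂ f q _ (hω.independent q hq), sub_eq_add_neg]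
  have hsymm : ∀ u v, extD (fderiv 𝕜 f : OneForm 𝕜) p u v = 0 := by
    intro u v
    have := (hf.contDiffAt (hV.mem_nhds hp)).isSymmSndFDerivAt
      (by
        rw [minSmoothness_of_isRCLikeNormedField]
        exact ENat.LEInfty.out)
    exact sub_eq_zero.2 (this.eq u v)
  have h0 := eq_zero_of_mul_wedge_eq_zero (hω.independent p hp) fun u v => by
    rw [← extD_combination hV hω hp hx hy.neg u v, ← extD_congr hgerm, hsymm]
  linear_combination h0

/-- The normalization `β₁ - α₂ = 1` of the web. -/
theorem D₁_beta (hV : IsOpen V) (hω : IsNormalizedWeb V ω₁ ω₂) {p : Plane 𝕜} (hp : p ∈ V) :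
    D₁ ω₁ ω₂ (beta ω₁ ω₂) p = 1 + D₂ ω₁ ω₂ (alpha ω₁ ω₂) p := by
  have hx := hasFrameDerivAt_of_contDiffOn (ω₁ := ω₁) (ω₂ := ω₂) hV (contDiffOn_beta hV hω) hp
  have hy := hasFrameDerivAt_of_contDiffOn (ω₁ := ω₁) (ω₂ := ω₂) hV (contDiffOn_alpha hV hω) hp
  have hfun : chern ω₁ ω₂ = fun q => beta ω₁ ω₂ q • ω₁ q + (-alpha ω₁ ω₂ q) • ω₂ q := by
    funext q
    ext <;> simp [chern, sub_eq_add_neg]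
  have h := fun u v => (extD_combination hV hω hp hx hy.neg u v).symm.trans
    (hfun ▸ hω.curvature p hp u v)
  have h0 := eq_zero_of_mul_wedge_eq_zero (k := D₁ ω₁ ω₂ (beta ω₁ ω₂) p -
    (1 + D₂ ω₁ ω₂ (alpha ω₁ ω₂) p)) (hω.independent p hp) fun u v => by
      linear_combination h u v
  linear_combination h0

/-! ### The curvature of `Ω_N` -/

/-- The coefficient of `U₁` in the matrix form `omegaForm`. -/
def coordU₁ (a c : 𝕜) : Matrix (Fin 3) (Fin 3) 𝕜 :=
  !![(-1 + 2 * a + c) / 3, 0, -c; a, (2 - a + c) / 3, -c; a, 0, (-1 - 2 * c - a) / 3]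

/-- The coefficient of `U₂` in the matrix form `omegaForm`. -/
def coordU₂ (b c : 𝕜) : Matrix (Fin 3) (Fin 3) 𝕜 :=
  !![(-2 - b + c) / 3, b, -c; 0, (1 + 2 * b + c) / 3, -c; 0, b, (1 - 2 * c - b) / 3]

theorem OmegaN_eq (N : Plane 𝕜 → 𝕜) (i j : Fin 3) :
    OmegaN ω₁ ω₂ N i j = fun p =>
      ((N p)⁻¹ * coordU₁ (aFun ω₁ ω₂ N p) (cFun ω₁ ω₂ N p) i j) • ω₁ p +
      ((N p)⁻¹ * coordU₂ (bFun ω₁ ω₂ N p) (cFun ω₁ ω₂ N p) i j) • ω₂ p := by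
  funext p
  refine ContinuousLinearMap.ext fun v => ?_
  fin_cases i <;> fin_cases j <;>
    simp [OmegaN, omegaForm, coordU₁, coordU₂, third] <;> ring

theorem evalForm_OmegaN (N : Plane 𝕜 → 𝕜) (p v : Plane 𝕜) :
    evalForm (OmegaN ω₁ ω₂ N) p v =
      ((N p)⁻¹ * ω₁ p v) • coordU₁ (aFun ω₁ ω₂ N p) (cFun ω₁ ω₂ N p) +
      ((N p)⁻¹ * ω₂ p v) • coordU₂ (bFun ω₁ ω₂ N p) (cFun ω₁ ω₂ N p) := by
  ext i j
  simp only [evalForm, Matrix.of_apply, OmegaN_eq, add_apply, smul_apply, smul_eq_mul,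
    Matrix.add_apply, Matrix.smul_apply]
  ring

/-- The curvature of `x ω₁ + y ω₂`, for matrices `x` and `y` of functions. -/
theorem curv_combination (hV : IsOpen V) (hω : IsNormalizedWeb V ω₁ ω₂) {Ω : MatForm 𝕜}
    {x y : Plane 𝕜 → Matrix (Fin 3) (Fin 3) 𝕜} {x₁ x₂ y₁ y₂ : Matrix (Fin 3) (Fin 3) 𝕜}
    (hΩ : ∀ i j, Ω i j = fun q => x q i j • ω₁ q + y q i j • ω₂ q) {p : Plane 𝕜} (hp : p ∈ V)
    (hx : ∀ i j, HasFrameDerivAt ω₁ ω₂ (fun q => x q i j) (x₁ i j) (x₂ i j) p)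
    (hy : ∀ i j, HasFrameDerivAt ω₁ ω₂ (fun q => y q i j) (y₁ i j) (y₂ i j) p) (u v : Plane 𝕜) :
    curv Ω p u v = wedge ω₁ ω₂ p u v •
      (x₁ + alpha ω₁ ω₂ p • x p + y₂ + beta ω₁ ω₂ p • y p + (x p * y p - y p * x p)) := by
  ext i j
  have h := extD_combination hV hω hp (hx i j) (hy i j) u v
  simp only [curv, Matrix.of_apply, Matrix.smul_apply, Matrix.add_apply, Matrix.sub_apply,
    Matrix.mul_apply, smul_eq_mul]
  rw [hΩ i j, h, mul_add, mul_comm, ← Finset.sum_sub_distrib, Finset.mul_sum]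
  congr 1
  refine Finset.sum_congr rfl fun k _ => ?_
  simp only [hΩ, wedge, add_apply, smul_apply, smul_eq_mul]
  ring

section

variable {N : Plane 𝕜 → 𝕜}

theorem contDiffOn_aFun (hV : IsOpen V) (hω : IsNormalizedWeb V ω₁ ω₂) (hN : ContDiffOn 𝕜 ∞ N V) :
    ContDiffOn 𝕜 ∞ (aFun ω₁ ω₂ N) V := by
  have hα := contDiffOn_alpha hV hω
  have hβ := contDiffOn_beta hV hω
  have h₁ := contDiffOn_D₁ hV hω hN
  have h₂ := contDiffOn_D₂ hV hω hN
  unfold aFun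
  fun_prop

theorem contDiffOn_bFun (hV : IsOpen V) (hω : IsNormalizedWeb V ω₁ ω₂) (hN : ContDiffOn 𝕜 ∞ N V) :
    ContDiffOn 𝕜 ∞ (bFun ω₁ ω₂ N) V := by
  have hα := contDiffOn_alpha hV hω
  have hβ := contDiffOn_beta hV hω
  have h₁ := contDiffOn_D₁ hV hω hN
  have h₂ := contDiffOn_D₂ hV hω hN
  unfold bFun
  fun_prop

theorem contDiffOn_cFun (hV : IsOpen V) (hω : IsNormalizedWeb V ω₁ ω₂) (hN : ContDiffOn 𝕜 ∞ N V) :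
    ContDiffOn 𝕜 ∞ (cFun ω₁ ω₂ N) V := by
  have hα := contDiffOn_alpha hV hω
  have hβ := contDiffOn_beta hV hω
  have h₁ := contDiffOn_D₁ hV hω hN
  have h₂ := contDiffOn_D₂ hV hω hN
  unfold cFun
  fun_prop

theorem contDiffOn_coordU₁ {a c : Plane 𝕜 → 𝕜} (ha : ContDiffOn 𝕜 ∞ a V)
    (hc : ContDiffOn 𝕜 ∞ c V) (i j : Fin 3) :
    ContDiffOn 𝕜 ∞ (fun p => coordU₁ (a p) (c p) i j) V := by
  fin_cases i <;> fin_cases j <;> simp [coordU₁] <;> fun_prop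

theorem contDiffOn_coordU₂ {b c : Plane 𝕜 → 𝕜} (hb : ContDiffOn 𝕜 ∞ b V)
    (hc : ContDiffOn 𝕜 ∞ c V) (i j : Fin 3) :
    ContDiffOn 𝕜 ∞ (fun p => coordU₂ (b p) (c p) i j) V := by
  fin_cases i <;> fin_cases j <;> simp [coordU₂] <;> fun_prop

theorem contDiffOn_OmegaN (hV : IsOpen V) (hω : IsNormalizedWeb V ω₁ ω₂)
    (hN : IsAdmissible N V) (i j : Fin 3) : ContDiffOn 𝕜 ∞ (OmegaN ω₁ ω₂ N i j) V := by
  have ha := contDiffOn_aFun hV hω hN.1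
  have hb := contDiffOn_bFun hV hω hN.1
  have hc := contDiffOn_cFun hV hω hN.1
  have hn : ContDiffOn 𝕜 ∞ (fun p => (N p)⁻¹) V := hN.1.inv hN.2
  rw [OmegaN_eq]
  exact ((hn.mul (contDiffOn_coordU₁ ha hc i j)).smul hω.smooth₁).add
    ((hn.mul (contDiffOn_coordU₂ hb hc i j)).smul hω.smooth₂)

theorem coordU₁_affine (a c : 𝕜) (i j : Fin 3) :
    coordU₁ a c i j = a * (coordU₁ 1 0 i j - coordU₁ 0 0 i j) +
      c * (coordU₁ 0 1 i j - coordU₁ 0 0 i j) + coordU₁ 0 0 i j := by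
  fin_cases i <;> fin_cases j <;> simp [coordU₁] <;> ring

/-- The rule for the derivative of a product with an affine function of `(a, c)`: subtracting
`coordU₁ 0 0` removes the constant term. -/
theorem HasFrameDerivAt.mul_coordU₁ {n a c : Plane 𝕜 → 𝕜} {n₁ n₂ a₁ a₂ c₁ c₂ : 𝕜}
    {p : Plane 𝕜} (hn : HasFrameDerivAt ω₁ ω₂ n n₁ n₂ p) (ha : HasFrameDerivAt ω₁ ω₂ a a₁ a₂ p)
    (hc : HasFrameDerivAt ω₁ ω₂ c c₁ c₂ p) (i j : Fin 3) :
    HasFrameDerivAt ω₁ ω₂ (fun q => n q * coordU₁ (a q) (c q) i j)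
      ((n₁ • coordU₁ (a p) (c p) + n p • (coordU₁ a₁ c₁ - coordU₁ 0 0) :
        Matrix (Fin 3) (Fin 3) 𝕜) i j)
      ((n₂ • coordU₁ (a p) (c p) + n p • (coordU₁ a₂ c₂ - coordU₁ 0 0) :
        Matrix (Fin 3) (Fin 3) 𝕜) i j) p := by
  have hl := (((ha.mul (.const (coordU₁ 1 0 i j - coordU₁ 0 0 i j))).add
      (hc.mul (.const (coordU₁ 0 1 i j - coordU₁ 0 0 i j)))).add (.const (coordU₁ 0 0 i j)))
  simp only [← coordU₁_affine] at hl
  refine (hn.mul hl).congr_deriv ?_ ?_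
  · simp only [Matrix.add_apply, Matrix.sub_apply, Matrix.smul_apply, smul_eq_mul]
    rw [coordU₁_affine a₁ c₁]
    ring
  · simp only [Matrix.add_apply, Matrix.sub_apply, Matrix.smul_apply, smul_eq_mul]
    rw [coordU₁_affine a₂ c₂]
    ring

theorem coordU₂_affine (b c : 𝕜) (i j : Fin 3) :
    coordU₂ b c i j = b * (coordU₂ 1 0 i j - coordU₂ 0 0 i j) +
      c * (coordU₂ 0 1 i j - coordU₂ 0 0 i j) + coordU₂ 0 0 i j := by
  fin_cases i <;> fin_cases j <;> simp [coordU₂] <;> ring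

theorem HasFrameDerivAt.mul_coordU₂ {n b c : Plane 𝕜 → 𝕜} {n₁ n₂ b₁ b₂ c₁ c₂ : 𝕜}
    {p : Plane 𝕜} (hn : HasFrameDerivAt ω₁ ω₂ n n₁ n₂ p) (hb : HasFrameDerivAt ω₁ ω₂ b b₁ b₂ p)
    (hc : HasFrameDerivAt ω₁ ω₂ c c₁ c₂ p) (i j : Fin 3) :
    HasFrameDerivAt ω₁ ω₂ (fun q => n q * coordU₂ (b q) (c q) i j)
      ((n₁ • coordU₂ (b p) (c p) + n p • (coordU₂ b₁ c₁ - coordU₂ 0 0) :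
        Matrix (Fin 3) (Fin 3) 𝕜) i j)
      ((n₂ • coordU₂ (b p) (c p) + n p • (coordU₂ b₂ c₂ - coordU₂ 0 0) :
        Matrix (Fin 3) (Fin 3) 𝕜) i j) p := by
  have hl := (((hb.mul (.const (coordU₂ 1 0 i j - coordU₂ 0 0 i j))).add
      (hc.mul (.const (coordU₂ 0 1 i j - coordU₂ 0 0 i j)))).add (.const (coordU₂ 0 0 i j)))
  simp only [← coordU₂_affine] at hl
  refine (hn.mul hl).congr_deriv ?_ ?_
  · simp only [Matrix.add_apply, Matrix.sub_apply, Matrix.smul_apply, smul_eq_mul]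
    rw [coordU₂_affine b₁ c₁]
    ring
  · simp only [Matrix.add_apply, Matrix.sub_apply, Matrix.smul_apply, smul_eq_mul]
    rw [coordU₂_affine b₂ c₂]
    ring

set_option maxHeartbeats 1000000 in
/-- All three rows of the curvature of `Ω_N` are `(K₁₁, K₂₂, -K₁₁ - K₂₂)`. -/
theorem curv_OmegaN (hV : IsOpen V) (hω : IsNormalizedWeb V ω₁ ω₂) (hN : IsAdmissible N V)
    {p : Plane 𝕜} (hp : p ∈ V) (u v : Plane 𝕜) :
    curv (OmegaN ω₁ ω₂ N) p u v = wedge ω₁ ω₂ p u v •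
      Matrix.of (fun _ : Fin 3 => ![K₁₁ ω₁ ω₂ N p, K₂₂ ω₁ ω₂ N p,
        -K₁₁ ω₁ ω₂ N p - K₂₂ ω₁ ω₂ N p]) := by
  have hN0 := hN.2 p hp
  have dN := hasFrameDerivAt_of_contDiffOn (ω₁ := ω₁) (ω₂ := ω₂) hV hN.1 hp
  have dN₁ := hasFrameDerivAt_of_contDiffOn (ω₁ := ω₁) (ω₂ := ω₂) hV (contDiffOn_D₁ hV hω hN.1) hp
  have dN₂ := hasFrameDerivAt_of_contDiffOn (ω₁ := ω₁) (ω₂ := ω₂) hV (contDiffOn_D₂ hV hω hN.1) hp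
  have dα := hasFrameDerivAt_of_contDiffOn (ω₁ := ω₁) (ω₂ := ω₂) hV (contDiffOn_alpha hV hω) hp
  have dβ := hasFrameDerivAt_of_contDiffOn (ω₁ := ω₁) (ω₂ := ω₂) hV (contDiffOn_beta hV hω) hp
  have hcomm := D_commutator hV hω hN.1 hp
  have hnorm := D₁_beta hV hω hp
  rw [hcomm] at dN₂
  rw [hnorm] at dβ
  have da := ((((dN.mul dN).const_mul (1 / 3)).add
    (((dβ.const_mul (2 / 3)).add (dα.const_mul (1 / 3))).mul dN)).sub
      (dN₁.const_mul (1 / 3))).sub (dN₂.const_mul (2 / 3))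
  have db := ((((dN.mul dN).const_mul (1 / 3)).sub
    (((dβ.const_mul (1 / 3)).add (dα.const_mul (2 / 3))).mul dN)).add
      (dN₁.const_mul (2 / 3))).add (dN₂.const_mul (1 / 3))
  have dc := ((((dN.mul dN).const_mul (1 / 3)).add
    (((dα.const_mul (1 / 3)).sub (dβ.const_mul (1 / 3))).mul dN)).sub
      (dN₁.const_mul (1 / 3))).add (dN₂.const_mul (1 / 3))
  replace da := da.congr_of_eventuallyEq (g := aFun ω₁ ω₂ N)
    (.of_forall fun q => by simp only [aFun]; ring)
  replace db := db.congr_of_eventuallyEq (g := bFun ω₁ ω₂ N)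
    (.of_forall fun q => by simp only [bFun]; ring)
  replace dc := dc.congr_of_eventuallyEq (g := cFun ω₁ ω₂ N)
    (.of_forall fun q => by simp only [cFun]; ring)
  rw [curv_combination hV hω
    (x := fun q => (N q)⁻¹ • coordU₁ (aFun ω₁ ω₂ N q) (cFun ω₁ ω₂ N q))
    (y := fun q => (N q)⁻¹ • coordU₂ (bFun ω₁ ω₂ N q) (cFun ω₁ ω₂ N q))
    (fun i j => OmegaN_eq N i j) hp
    (fun i j => (dN.inv hN0).mul_coordU₁ da dc i j)
    (fun i j => (dN.inv hN0).mul_coordU₂ db dc i j)]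
  congr 1
  obtain ⟨a, ha⟩ : ∃ a, a = aFun ω₁ ω₂ N p := ⟨_, rfl⟩
  obtain ⟨b, hb⟩ : ∃ b, b = bFun ω₁ ω₂ N p := ⟨_, rfl⟩
  obtain ⟨c, hc⟩ : ∃ c, c = cFun ω₁ ω₂ N p := ⟨_, rfl⟩
  simp only [K₁₁, K₂₂, hcomm, hnorm, ← ha, ← hb, ← hc]
  clear da db dc dN dN₁ dN₂ dα dβ hcomm hnorm hN hω hV hp
  simp only [aFun] at ha
  simp only [bFun] at hb
  simp only [cFun] at hc
  generalize D₁ ω₁ ω₂ (D₁ ω₁ ω₂ N) p = N₁₁ at *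
  generalize D₂ ω₁ ω₂ (D₁ ω₁ ω₂ N) p = N₁₂ at *
  generalize D₂ ω₁ ω₂ (D₂ ω₁ ω₂ N) p = N₂₂ at *
  generalize D₁ ω₁ ω₂ N p = N₁ at *
  generalize D₂ ω₁ ω₂ N p = N₂ at *
  generalize D₁ ω₁ ω₂ (alpha ω₁ ω₂) p = α₁ at *
  generalize D₂ ω₁ ω₂ (alpha ω₁ ω₂) p = α₂ at *
  generalize D₂ ω₁ ω₂ (beta ω₁ ω₂) p = β₂ at *
  generalize alpha ω₁ ω₂ p = α at *
  generalize beta ω₁ ω₂ p = β at *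
  generalize N p = n at *
  subst ha hb hc
  ext i j
  fin_cases i <;> fin_cases j <;>
    simp [coordU₁, coordU₂, -neg_sub, -neg_add_rev] <;> field_simp <;> ring

end

/-! ### Developments along leaves -/

/-- The matrix `T` preserves the line spanned by the basis vector `eᵢ` and the plane spanned by `eᵢ`
and `(1, 1, 1)`. The values of `Ω_N` on vectors tangent to the leaves of the `i`-th foliation
(counted from `0`) have this property. -/
def PreservesFlag (i : Fin 3) (T : Matrix (Fin 3) (Fin 3) 𝕜) : Prop :=
  (∀ j ≠ i, T j i = 0) ∧ ∀ j ≠ i, ∀ k ≠ i, (T *ᵥ 1) j = (T *ᵥ 1) k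

section ode

variable {s₀ : 𝕜} {r : ℝ} {T : 𝕜 → Matrix (Fin 3) (Fin 3) 𝕜}

/-- In the basis `e₀`, `(0, 1, 1)`, `e₂` a matrix that preserves the flag of index `0` is upper
triangular, so that the development is found by quadratures. -/
theorem exists_development_zero
    (hT : ∀ i j, DifferentiableOn 𝕜 (fun s => T s i j) (ball s₀ r))
    (htr : ∀ s ∈ ball s₀ r, (T s).trace = 0)
    (hfl : ∀ s ∈ ball s₀ r, PreservesFlag 0 (T s)) :
    ∃ F : 𝕜 → Matrix (Fin 3) (Fin 3) 𝕜, (∀ s, (F s).det = 1) ∧ F s₀ = 1 ∧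
      ∀ s ∈ ball s₀ r, ∀ i j, HasDerivAt (fun t => F t i j) ((F s * T s) i j) s := by
  have hcol : ∀ s ∈ ball s₀ r, T s 1 0 = 0 ∧ T s 2 0 = 0 ∧
      T s 1 1 + T s 1 2 = T s 2 1 + T s 2 2 := by
    intro s hs
    have h1 := (hfl s hs).1 1 (by decide)
    have h2 := (hfl s hs).1 2 (by decide)
    refine ⟨h1, h2, ?_⟩
    simpa [Matrix.mulVec, dotProduct, Fin.sum_univ_three, h1, h2] using
      (hfl s hs).2 1 (by decide) 2 (by decide)
  have hd : ∀ {g g' : 𝕜 → 𝕜}, (∀ s ∈ ball s₀ r, HasDerivAt g (g' s) s) →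
      DifferentiableOn 𝕜 g (ball s₀ r) :=
    fun h s hs => (h s hs).differentiableAt.differentiableWithinAt
  have hT00 := hT 0 0
  have hT01 := hT 0 1
  have hT02 := hT 0 2
  have hT11 := hT 1 1
  have hT12 := hT 1 2
  have hT22 := hT 2 2
  obtain ⟨x, hx0, hxne, hx⟩ := exists_solution_linear hT00
  obtain ⟨w, hw0, hwne, hw⟩ := exists_solution_linear (hT11.add hT12)
  have hxd := hd hx
  have hwd := hd hw
  obtain ⟨y, hy0, hy⟩ := exists_solution_affine (hT11.add hT12) (hxd.mul (hT01.add hT02))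
  have hyd := hd hy
  obtain ⟨z, hz0, hz⟩ := exists_solution_affine (hT22.sub hT12)
    ((hxd.mul hT02).add (hyd.mul hT12))
  obtain ⟨q, hq0, hq⟩ := exists_solution_affine (hT22.sub hT12) (hwd.mul hT12)
  have hρ : ∀ s ∈ ball s₀ r, HasDerivAt (fun t => (x t * w t)⁻¹)
      ((x s * w s)⁻¹ * (T s 2 2 - T s 1 2)) s := by
    intro s hs
    have h := ((hx s hs).mul (hw s hs)).inv (mul_ne_zero (hxne s) (hwne s))
    refine h.congr_deriv ?_
    have htr' := htr s hs
    rw [Matrix.trace_fin_three] at htr'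
    have h1 := hxne s
    have h2 := hwne s
    simp only [Pi.add_apply, Pi.mul_apply]
    field_simp
    linear_combination -htr'
  -- `x`, `w` and `(x w)⁻¹` are the diagonal entries in the basis `e₀`, `(0, 1, 1)`, `e₂`
  refine ⟨fun s => !![x s, y s - z s, z s; 0, w s - q s, q s;
    0, w s - q s - (x s * w s)⁻¹, q s + (x s * w s)⁻¹], fun s => ?_, ?_, ?_⟩
  · have h1 := hxne s
    have h2 := hwne s
    simp only [Matrix.det_fin_three, Matrix.of_apply, Matrix.cons_val', Matrix.cons_val_zero,
      Matrix.cons_val_one, Matrix.cons_val]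
    field_simp
    ring
  · ext i j
    fin_cases i <;> fin_cases j <;> simp [hx0, hw0, hy0, hz0, hq0]
  · intro s hs i j
    obtain ⟨h10, h20, hsum⟩ := hcol s hs
    have ex := hx s hs
    have ew := hw s hs
    have ey := hy s hs
    have ez := hz s hs
    have eq := hq s hs
    have er := hρ s hs
    have e21 : T s 2 1 = T s 1 1 + T s 1 2 - T s 2 2 := by linear_combination -hsum
    fin_cases i <;> fin_cases j
    · refine ex.congr_deriv ?_
      simp [Matrix.mul_apply, Fin.sum_univ_three, h10, h20]
    · refine (ey.sub ez).congr_deriv ?_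
      simp [Matrix.mul_apply, Fin.sum_univ_three, e21]
      ring
    · refine ez.congr_deriv ?_
      simp [Matrix.mul_apply, Fin.sum_univ_three]
      ring
    · refine (hasDerivAt_const s (0 : 𝕜)).congr_deriv ?_
      simp [Matrix.mul_apply, Fin.sum_univ_three, h10, h20]
    · refine (ew.sub eq).congr_deriv ?_
      simp [Matrix.mul_apply, Fin.sum_univ_three, e21]
      ring
    · refine eq.congr_deriv ?_
      simp [Matrix.mul_apply, Fin.sum_univ_three]
      ring
    · refine (hasDerivAt_const s (0 : 𝕜)).congr_deriv ?_
      simp [Matrix.mul_apply, Fin.sum_univ_three, h10, h20]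
    · refine ((ew.sub eq).sub er).congr_deriv ?_
      simp [Matrix.mul_apply, Fin.sum_univ_three, e21]
      ring
    · refine (eq.add er).congr_deriv ?_
      simp [Matrix.mul_apply, Fin.sum_univ_three]
      ring

/-- The case of a flag of index `i` reduces to that of index `0` by a cyclic permutation of the
basis. -/
theorem exists_development (i : Fin 3)
    (hT : ∀ i j, DifferentiableOn 𝕜 (fun s => T s i j) (ball s₀ r))
    (htr : ∀ s ∈ ball s₀ r, (T s).trace = 0)
    (hfl : ∀ s ∈ ball s₀ r, PreservesFlag i (T s)) :
    ∃ F : 𝕜 → Matrix (Fin 3) (Fin 3) 𝕜, (∀ s, (F s).det = 1) ∧ F s₀ = 1 ∧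
      ∀ s ∈ ball s₀ r, ∀ i j, HasDerivAt (fun t => F t i j) ((F s * T s) i j) s := by
  let σ : Fin 3 ≃ Fin 3 := Equiv.addLeft i
  have hσ : σ 0 = i := by simp [σ]
  have hne : ∀ j ≠ 0, σ j ≠ i := fun j hj h => hj (σ.injective (h.trans hσ.symm))
  have hmv : ∀ s j, ((T s).submatrix σ σ *ᵥ 1) j = (T s *ᵥ 1) (σ j) := by
    intro s j
    rw [Matrix.submatrix_mulVec_equiv]
    rfl
  obtain ⟨F, hdet, h1, hF⟩ := exists_development_zero (T := fun s => (T s).submatrix σ σ)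
    (fun j k => hT _ _) (fun s hs => by
      rw [← htr s hs]
      exact σ.sum_comp fun j => T s j j)
    (fun s hs => ⟨fun j hj => by
        rw [Matrix.submatrix_apply, hσ]
        exact (hfl s hs).1 _ (hne j hj),
      fun j hj k hk => by
        rw [hmv, hmv]
        exact (hfl s hs).2 _ (hne j hj) _ (hne k hk)⟩)
  refine ⟨fun s => (F s).submatrix σ.symm σ.symm, fun s => ?_, ?_, fun s hs j k => ?_⟩
  · rw [Matrix.det_submatrix_equiv_self, hdet]
  · simp [h1]
  · have h := hF s hs (σ.symm j) (σ.symm k)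
    refine h.congr_deriv ?_
    have : T s = ((T s).submatrix σ σ).submatrix σ.symm σ.symm := by simp
    conv_rhs => rw [this, Matrix.submatrix_mul_equiv]
    rfl

/-- A solution of `R' = R T` maps `(1, 1, 1)` into a fixed line of the projective plane, if `T`
preserves a flag. -/
theorem exists_line_of_preservesFlag {R : 𝕜 → Matrix (Fin 3) (Fin 3) 𝕜} (i : Fin 3)
    (hT : ∀ i j, DifferentiableOn 𝕜 (fun s => T s i j) (ball s₀ r))
    (hfl : ∀ s ∈ ball s₀ r, PreservesFlag i (T s))
    (hR : ∀ s ∈ ball s₀ r, ∀ i j, HasDerivAt (fun t => R t i j) ((R s * T s) i j) s) :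
    ∃ ℓ : Fin 3 → 𝕜, ℓ ≠ 0 ∧ ∀ s ∈ ball s₀ r, ℓ ⬝ᵥ (R s *ᵥ 1) = 0 := by
  obtain ⟨ℓ, hℓ, hℓ0⟩ : ∃ ℓ : Fin 3 → 𝕜, ℓ ≠ 0 ∧
      !![R s₀ 0 i, R s₀ 1 i, R s₀ 2 i; (R s₀ *ᵥ 1) 0, (R s₀ *ᵥ 1) 1, (R s₀ *ᵥ 1) 2] *ᵥ ℓ = 0 := by
    have := LinearMap.ker_ne_bot_of_finrank_lt (K := 𝕜) (f := Matrix.mulVecLin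
      !![R s₀ 0 i, R s₀ 1 i, R s₀ 2 i; (R s₀ *ᵥ 1) 0, (R s₀ *ᵥ 1) 1, (R s₀ *ᵥ 1) 2]) (by simp)
    obtain ⟨ℓ, h, hne⟩ := (Submodule.ne_bot_iff _).1 this
    exact ⟨ℓ, hne, h⟩
  refine ⟨ℓ, hℓ, ?_⟩
  -- the row vector `ρ = ℓ R` satisfies `ρ' = ρ T`
  have hρ : ∀ s ∈ ball s₀ r, ∀ j, HasDerivAt (fun t => (ℓ ᵥ* R t) j) ((ℓ ᵥ* R s ᵥ* T s) j) s := by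
    intro s hs j
    rw [Matrix.vecMul_vecMul]
    exact HasDerivAt.fun_sum (u := Finset.univ) fun k _ => (hR s hs k j).const_mul (ℓ k)
  have hg : ∀ s ∈ ball s₀ r, (ℓ ᵥ* R s) i = 0 := by
    refine eqOn_zero_of_hasDerivAt_mul (hT i i) (fun s hs => ?_) ?_
    · refine (hρ s hs i).congr_deriv ?_
      rw [Matrix.vecMul, dotProduct, Finset.sum_eq_single i]
      · intro j _ hj
        rw [(hfl s hs).1 j hj, mul_zero]
      · simp
    · simpa [Matrix.mulVec, Matrix.vecMul, dotProduct, Fin.sum_univ_three, mul_comm]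
        using congrFun hℓ0 0
  have hne : i + 1 ≠ i := by simp
  simp only [Matrix.dotProduct_mulVec]
  refine eqOn_zero_of_hasDerivAt_mul (m := fun s => (T s *ᵥ 1) (i + 1))
    ?_ (fun s hs => ?_) ?_
  · simp only [Matrix.mulVec, dotProduct, Pi.one_apply, mul_one]
    exact DifferentiableOn.fun_sum fun j _ => hT (i + 1) j
  · have hsum := HasDerivAt.fun_sum (u := Finset.univ) fun j _ => hρ s hs j
    have h1 : ∀ v : Fin 3 → 𝕜, v ⬝ᵥ 1 = ∑ j, v j := fun v => by simp [dotProduct]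
    simp only [h1]
    refine hsum.congr_deriv ?_
    rw [← h1, ← Matrix.dotProduct_mulVec, dotProduct, Finset.sum_mul]
    refine Finset.sum_congr rfl fun j _ => ?_
    by_cases hj : j = i
    · rw [hj, hg s hs, zero_mul, zero_mul]
    · rw [(hfl s hs).2 j hj (i + 1) hne]
  · rw [← Matrix.dotProduct_mulVec]
    simpa [Matrix.mulVec, dotProduct, Fin.sum_univ_three, mul_comm]
        using congrFun hℓ0 1

end ode

/-! ### The Cartan gauge `Ω_N` -/

theorem exists_coordU₁_mulVec_one (a c : 𝕜) : ∃ l : 𝕜,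
    coordU₁ a c *ᵥ 1 = l • (1 : Fin 3 → 𝕜) + ![0, 1, 0] := by
  refine ⟨(-1 + 2 * a - 2 * c) / 3, ?_⟩
  ext i
  fin_cases i <;> simp [coordU₁, Matrix.mulVec, dotProduct, Fin.sum_univ_three] <;> ring

theorem exists_coordU₂_mulVec_one (b c : 𝕜) : ∃ l : 𝕜,
    coordU₂ b c *ᵥ 1 = l • (1 : Fin 3 → 𝕜) + ![-1, 0, 0] := by
  refine ⟨(1 + 2 * b - 2 * c) / 3, ?_⟩
  ext i
  fin_cases i <;> simp [coordU₂, Matrix.mulVec, dotProduct, Fin.sum_univ_three] <;> ring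

/-- Modulo `(1, 1, 1)`, the form `Ω_N` maps `(1, 1, 1)` to `(-U₂, U₁, 0)`. -/
theorem evalForm_OmegaN_mulVec_one (N : Plane 𝕜 → 𝕜) (p v : Plane 𝕜) :
    ∃ l : 𝕜, evalForm (OmegaN ω₁ ω₂ N) p v *ᵥ 1 =
      l • (1 : Fin 3 → 𝕜) + ![-((N p)⁻¹ * ω₂ p v), (N p)⁻¹ * ω₁ p v, 0] := by
  obtain ⟨l₁, h₁⟩ := exists_coordU₁_mulVec_one (aFun ω₁ ω₂ N p) (cFun ω₁ ω₂ N p)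
  obtain ⟨l₂, h₂⟩ := exists_coordU₂_mulVec_one (bFun ω₁ ω₂ N p) (cFun ω₁ ω₂ N p)
  refine ⟨((N p)⁻¹ * ω₁ p v) * l₁ + ((N p)⁻¹ * ω₂ p v) * l₂, ?_⟩
  rw [evalForm_OmegaN, Matrix.add_mulVec, Matrix.smul_mulVec, Matrix.smul_mulVec, h₁, h₂]
  ext i
  fin_cases i <;> simp [Matrix.vecHead, Matrix.vecTail] <;> ring

theorem trace_evalForm_OmegaN (N : Plane 𝕜 → 𝕜) (p v : Plane 𝕜) :
    (evalForm (OmegaN ω₁ ω₂ N) p v).trace = 0 := by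
  rw [evalForm_OmegaN, Matrix.trace_add, Matrix.trace_smul, Matrix.trace_smul]
  simp [coordU₁, coordU₂, Matrix.trace_fin_three]
  ring

theorem preservesFlag_leaf₁ (N : Plane 𝕜 → 𝕜) {p v : Plane 𝕜} (h : ω₁ p v = 0) :
    PreservesFlag 0 (evalForm (OmegaN ω₁ ω₂ N) p v) := by
  refine ⟨fun j hj => ?_, fun j hj k hk => ?_⟩
  · rw [evalForm_OmegaN, h]
    fin_cases j <;> simp_all [coordU₂]
  · obtain ⟨l, hl⟩ := evalForm_OmegaN_mulVec_one (ω₁ := ω₁) (ω₂ := ω₂) N p v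
    rw [hl, h]
    fin_cases j <;> fin_cases k <;> simp_all

theorem preservesFlag_leaf₂ (N : Plane 𝕜 → 𝕜) {p v : Plane 𝕜} (h : ω₂ p v = 0) :
    PreservesFlag 1 (evalForm (OmegaN ω₁ ω₂ N) p v) := by
  refine ⟨fun j hj => ?_, fun j hj k hk => ?_⟩
  · rw [evalForm_OmegaN, h]
    fin_cases j <;> simp_all [coordU₁]
  · obtain ⟨l, hl⟩ := evalForm_OmegaN_mulVec_one (ω₁ := ω₁) (ω₂ := ω₂) N p v
    rw [hl, h]
    fin_cases j <;> fin_cases k <;> simp_all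

theorem preservesFlag_leaf₃ (N : Plane 𝕜 → 𝕜) {p v : Plane 𝕜} (h : third ω₁ ω₂ p v = 0) :
    PreservesFlag 2 (evalForm (OmegaN ω₁ ω₂ N) p v) := by
  have h' : ω₂ p v = -ω₁ p v := by
    have h1 : -(ω₁ p v + ω₂ p v) = 0 := h
    linear_combination -h1
  refine ⟨fun j hj => ?_, fun j hj k hk => ?_⟩
  · rw [evalForm_OmegaN, h']
    fin_cases j <;> simp_all [coordU₁, coordU₂]
  · obtain ⟨l, hl⟩ := evalForm_OmegaN_mulVec_one (ω₁ := ω₁) (ω₂ := ω₂) N p v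
    rw [hl, h']
    fin_cases j <;> fin_cases k <;> simp_all

theorem differentiableOn_evalForm_arc {V : Set (Plane 𝕜)} {θ : OneForm 𝕜} {Ω : MatForm 𝕜}
    (hΩ : ∀ i j, ContDiffOn 𝕜 ∞ (Ω i j) V) {s₀ : 𝕜} {r : ℝ} {c : 𝕜 → Plane 𝕜}
    (hc : IsLeafArc θ V s₀ r c) (i j : Fin 3) :
    DifferentiableOn 𝕜 (fun s => evalForm Ω (c s) (deriv c s) i j) (ball s₀ r) := by
  have h1 : ContDiffOn 𝕜 ∞ (fun s => Ω i j (c s)) (ball s₀ r) :=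
    (hΩ i j).comp hc.1 fun s hs => (hc.2 s hs).1
  have h2 : ContDiffOn 𝕜 ∞ (deriv c) (ball s₀ r) :=
    ((contDiffOn_infty_iff_deriv_of_isOpen isOpen_ball).1 hc.1).2
  exact (h1.clm_apply h2).differentiableOn (by simp)

theorem isGeodesicArc_of_preservesFlag {θ : OneForm 𝕜} {Ω : MatForm 𝕜}
    (hΩ : ∀ i j, ContDiffOn 𝕜 ∞ (Ω i j) V) (htr : ∀ p v, (evalForm Ω p v).trace = 0) (i : Fin 3)
    (hfl : ∀ p v, θ p v = 0 → PreservesFlag i (evalForm Ω p v)) : LeavesAreGeodesics θ V Ω := by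
  intro s₀ r c hc
  have hd := differentiableOn_evalForm_arc hΩ hc
  have hflag : ∀ s ∈ ball s₀ r, PreservesFlag i (evalForm Ω (c s) (deriv c s)) :=
    fun s hs => hfl _ _ (hc.2 s hs).2.2
  obtain ⟨F, hdet, h1, hF⟩ := exists_development i hd (fun s _ => htr _ _) hflag
  obtain ⟨ℓ, hℓ, hline⟩ := exists_line_of_preservesFlag i hd hflag hF
  exact ⟨fun s => ⟨F s, hdet s⟩, ⟨Subtype.ext h1, hF⟩, ℓ, hℓ, hline⟩

theorem mem_sl_of_trace_eq_zero {A : Matrix (Fin 3) (Fin 3) 𝕜} (h : A.trace = 0) :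
    A ∈ LieAlgebra.SpecialLinear.sl (Fin 3) 𝕜 :=
  LinearMap.mem_ker.2 h

theorem isCartanGauge_OmegaN {N : Plane 𝕜 → 𝕜} (hV : IsOpen V) (hω : IsNormalizedWeb V ω₁ ω₂)
    (hN : IsAdmissible N V) : IsCartanGauge V (OmegaN ω₁ ω₂ N) := by
  refine ⟨contDiffOn_OmegaN hV hω hN,
    fun p _ v => mem_sl_of_trace_eq_zero (trace_evalForm_OmegaN N p v),
    fun p hp => ⟨fun v w hvw => ?_, fun q => ?_⟩⟩
  · have hN0 := hN.2 p hp
    have hw := hω.independent p hp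
    obtain ⟨l, hl⟩ := (Submodule.Quotient.eq _).1 hvw
    obtain ⟨lv, hv⟩ := evalForm_OmegaN_mulVec_one (ω₁ := ω₁) (ω₂ := ω₂) N p v
    obtain ⟨lw, hw'⟩ := evalForm_OmegaN_mulVec_one (ω₁ := ω₁) (ω₂ := ω₂) N p w
    have hl' : evalForm (OmegaN ω₁ ω₂ N) p v *ᵥ 1 - evalForm (OmegaN ω₁ ω₂ N) p w *ᵥ 1 =
        l • 1 := by
      rw [← Matrix.sub_mulVec]
      exact hl
    rw [hv, hw'] at hl'
    have e0 := congrFun hl' 0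
    have e1 := congrFun hl' 1
    have e2 := congrFun hl' 2
    simp [Matrix.vecHead, Matrix.vecTail] at e0 e1 e2
    have i1 : ω₁ p v = ω₁ p w := by
      have : (N p)⁻¹ * (ω₁ p v - ω₁ p w) = 0 := by linear_combination e1 - e2
      exact sub_eq_zero.1 ((mul_eq_zero.1 this).resolve_left (inv_ne_zero hN0))
    have i2 : ω₂ p v = ω₂ p w := by
      have : (N p)⁻¹ * (ω₂ p v - ω₂ p w) = 0 := by linear_combination e2 - e0
      exact sub_eq_zero.1 ((mul_eq_zero.1 this).resolve_left (inv_ne_zero hN0))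
    rw [eq_frame_combination hw v, eq_frame_combination hw w, i1, i2]
  · obtain ⟨A, rfl⟩ := Submodule.mkQ_surjective _ q
    have hN0 := hN.2 p hp
    have hw := hω.independent p hp
    set A' : Matrix (Fin 3) (Fin 3) 𝕜 := A.1 with hA'
    set x := N p * ((A' *ᵥ 1) 1 - (A' *ᵥ 1) 2) with hx
    set y := N p * ((A' *ᵥ 1) 2 - (A' *ᵥ 1) 0) with hy
    refine ⟨x • frame₂ ω₁ ω₂ p - y • frame₁ ω₁ ω₂ p, (Submodule.Quotient.eq _).2 ?_⟩
    obtain ⟨l, hl⟩ := evalForm_OmegaN_mulVec_one (ω₁ := ω₁) (ω₂ := ω₂) N p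
      (x • frame₂ ω₁ ω₂ p - y • frame₁ ω₁ ω₂ p)
    refine ⟨l - (A' *ᵥ 1) 2, ?_⟩
    have hsub : evalForm (OmegaN ω₁ ω₂ N) p (x • frame₂ ω₁ ω₂ p - y • frame₁ ω₁ ω₂ p) *ᵥ 1 -
        A' *ᵥ 1 = (l - (A' *ᵥ 1) 2) • 1 := by
      rw [hl]
      simp only [map_sub, map_smul, form₁_frame₁, form₂_frame₂, form₂_frame₁ hw, form₁_frame₂ hw]
      ext i
      fin_cases i <;> simp [hx, hy, hN0, Matrix.vecHead, Matrix.vecTail] <;> ring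
    rw [← Matrix.sub_mulVec] at hsub
    exact hsub

theorem isTorsionFree_OmegaN {N : Plane 𝕜 → 𝕜} (hV : IsOpen V) (hω : IsNormalizedWeb V ω₁ ω₂)
    (hN : IsAdmissible N V) : IsTorsionFree V (OmegaN ω₁ ω₂ N) := by
  intro p hp u v
  have h := curv_OmegaN hV hω hN hp u v
  refine ⟨mem_sl_of_trace_eq_zero ?_, 0, ?_⟩
  · rw [h, Matrix.trace_smul, Matrix.trace_fin_three]
    simp
  · change curv (OmegaN ω₁ ω₂ N) p u v *ᵥ 1 = _
    rw [h, Matrix.smul_mulVec]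
    ext i
    simp [Matrix.mulVec, dotProduct, Fin.sum_univ_three]

theorem isFlat_OmegaN_iff {N : Plane 𝕜 → 𝕜} (hV : IsOpen V) (hω : IsNormalizedWeb V ω₁ ω₂)
    (hN : IsAdmissible N V) : IsFlat V (OmegaN ω₁ ω₂ N) ↔
      ∀ p ∈ V, K₁₁ ω₁ ω₂ N p = 0 ∧ K₂₂ ω₁ ω₂ N p = 0 := by
  refine forall₂_congr fun p hp => ⟨fun h => ?_, fun h u v => ?_⟩
  · have h1 := (curv_OmegaN hV hω hN hp (1, 0) (0, 1)).symm.trans (h _ _)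
    have h2 := (smul_eq_zero.1 h1).resolve_left (hω.independent p hp)
    exact ⟨by simpa using congrFun (congrFun h2 0) 0, by simpa using congrFun (congrFun h2 0) 1⟩
  · rw [curv_OmegaN hV hω hN hp, h.1, h.2]
    ext i j
    fin_cases j <;> simp

/-! ### Flat connections are linearizations -/

/-- The right-hand side of the system `dp = dp`, `df = f Ω` for a point `p` and a row vector `f`. -/
def parallelField (Ω : MatForm 𝕜) (x : Plane 𝕜 × (Fin 3 → 𝕜)) :
    Plane 𝕜 →L[𝕜] Plane 𝕜 × (Fin 3 → 𝕜) :=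
  (ContinuousLinearMap.id 𝕜 (Plane 𝕜)).prod
    (ContinuousLinearMap.pi fun j => ∑ k, x.2 k • Ω k j x.1)

theorem parallelField_apply (Ω : MatForm 𝕜) (x : Plane 𝕜 × (Fin 3 → 𝕜)) (v : Plane 𝕜) :
    parallelField Ω x v = (v, fun j => ∑ k, x.2 k * Ω k j x.1 v) := by
  ext <;> simp [parallelField]

theorem contDiffOn_parallelField {Ω : MatForm 𝕜} (hΩ : ∀ i j, ContDiffOn 𝕜 ∞ (Ω i j) V) :
    ContDiffOn 𝕜 ∞ (parallelField Ω) (V ×ˢ univ) := by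
  rw [contDiffOn_clm_apply]
  intro v
  simp only [parallelField_apply]
  refine contDiffOn_const.prodMk (contDiffOn_pi.2 fun j => ContDiffOn.sum fun k _ => ?_)
  refine ContDiffOn.mul (by fun_prop) ?_
  exact ((hΩ k j).comp contDiffOn_fst fun x hx => hx.1).clm_apply contDiffOn_const

/-- The integrability condition of the system `df = f Ω` is `f K = 0`. -/
theorem fderiv_parallelField_comm {Ω : MatForm 𝕜} (hV : IsOpen V)
    (hΩ : ∀ i j, ContDiffOn 𝕜 ∞ (Ω i j) V) {x : Plane 𝕜 × (Fin 3 → 𝕜)} (hx : x.1 ∈ V)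
    (hflat : ∀ u v, curv Ω x.1 u v = 0) (u v : Plane 𝕜) :
    fderiv 𝕜 (parallelField Ω) x (parallelField Ω x u) v =
      fderiv 𝕜 (parallelField Ω) x (parallelField Ω x v) u := by
  have hd : DifferentiableAt 𝕜 (parallelField Ω) x :=
    ((contDiffOn_parallelField hΩ).contDiffAt
      ((hV.prod isOpen_univ).mem_nhds ⟨hx, trivial⟩)).differentiableAt (by simp)
  have hΩd : ∀ k j, HasFDerivAt (Ω k j) (fderiv 𝕜 (Ω k j) x.1) x.1 := fun k j =>
    (differentiableAt_of_contDiffOn hV (hΩ k j) hx).hasFDerivAt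
  have key : ∀ v w : Plane 𝕜, fderiv 𝕜 (parallelField Ω) x (parallelField Ω x w) v =
      (0, fun j => ∑ k, (x.2 k * fderiv 𝕜 (Ω k j) x.1 w v +
        (∑ l, x.2 l * Ω l k x.1 w) * Ω k j x.1 v)) := by
    intro v w
    have h1 : fderiv 𝕜 (parallelField Ω) x (parallelField Ω x w) v =
        fderiv 𝕜 (fun y => parallelField Ω y v) x (parallelField Ω x w) := by
      rw [fderiv_clm_apply hd (differentiableAt_const v)]
      simp
    have hcomp : ∀ k j, HasFDerivAt (fun y : Plane 𝕜 × (Fin 3 → 𝕜) => Ω k j y.1 v)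
        (((fderiv 𝕜 (Ω k j) x.1).flip v).comp (.fst 𝕜 _ _)) x := by
      intro k j
      have h2 := ((hΩd k j).comp x hasFDerivAt_fst).clm_apply (hasFDerivAt_const v x)
      refine h2.congr_fderiv ?_
      ext <;> simp
    have hproj : ∀ k, HasFDerivAt (fun y : Plane 𝕜 × (Fin 3 → 𝕜) => y.2 k)
        ((ContinuousLinearMap.proj k).comp (.snd 𝕜 _ _)) x := fun k =>
      ((ContinuousLinearMap.proj (R := 𝕜) (φ := fun _ : Fin 3 => 𝕜) k).comp
        (.snd 𝕜 (Plane 𝕜) _)).hasFDerivAt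
    have h3 : HasFDerivAt (fun y => parallelField Ω y v)
        ((0 : _ →L[𝕜] Plane 𝕜).prod (ContinuousLinearMap.pi fun j => ∑ k,
          (x.2 k • ((fderiv 𝕜 (Ω k j) x.1).flip v).comp (.fst 𝕜 _ _) +
            Ω k j x.1 v • (ContinuousLinearMap.proj k).comp (.snd 𝕜 _ _)))) x := by
      simp only [parallelField_apply]
      exact (hasFDerivAt_const v x).prodMk (hasFDerivAt_pi.2 fun j =>
        HasFDerivAt.fun_sum fun k _ => (hproj k).mul (hcomp k j))
    rw [h1, h3.fderiv, parallelField_apply]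
    refine Prod.ext rfl (funext fun j => ?_)
    simp [mul_comm]
  rw [key, key]
  refine Prod.ext rfl (funext fun j => ?_)
  have h0 : ∑ k, x.2 k * curv Ω x.1 u v k j = 0 := by simp [hflat]
  rw [← sub_eq_zero, ← h0]
  simp only [curv, extD, wedge, Matrix.of_apply, Fin.sum_univ_three]
  ring

/-- A flat connection has parallel row vectors with any given initial value. -/
theorem exists_parallel_row {Ω : MatForm 𝕜} (hV : IsOpen V)
    (hΩ : ∀ i j, ContDiffOn 𝕜 ∞ (Ω i j) V) (hflat : IsFlat V Ω) {p₀ : Plane 𝕜} (hp₀ : p₀ ∈ V)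
    (e : Fin 3 → 𝕜) : ∃ f : Plane 𝕜 → Fin 3 → 𝕜, f p₀ = e ∧
      ∀ᶠ p in 𝓝 p₀, HasFDerivAt f (ContinuousLinearMap.pi fun j => ∑ k, f p k • Ω k j p) p := by
  have hnhds : V ×ˢ (univ : Set (Fin 3 → 𝕜)) ∈ 𝓝 (p₀, e) :=
    (hV.prod isOpen_univ).mem_nhds ⟨hp₀, trivial⟩
  obtain ⟨f, hf0, hf⟩ := exists_hasFDerivAt_of_commuting
    (((contDiffOn_parallelField hΩ).contDiffAt hnhds).of_le (m := 2) ENat.LEInfty.out)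
    (by filter_upwards [hnhds] with x hx
        exact fderiv_parallelField_comm hV hΩ hx.1 (hflat x.1 hx.1))
  have htend : Tendsto (fun p : Plane 𝕜 => p - p₀) (𝓝 p₀) (𝓝 0) := by
    exact Continuous.tendsto' (by fun_prop) _ _ (sub_self p₀)
  have hg : ∀ᶠ p in 𝓝 p₀, HasFDerivAt (fun p => f (p - p₀)) (parallelField Ω (f (p - p₀))) p := by
    filter_upwards [htend.eventually hf] with p hp
    exact (hasFDerivAt_comp_sub p₀).2 hp
  -- the first component of the solution is the identity
  obtain ⟨ε, hε, hball⟩ := Metric.eventually_nhds_iff_ball.1 hg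
  have hfst : ∀ p ∈ ball p₀ ε, (f (p - p₀)).1 = p := by
    have hd : ∀ p ∈ ball p₀ ε, HasFDerivAt (fun p => (f (p - p₀)).1 - p)
        (0 : Plane 𝕜 →L[𝕜] Plane 𝕜) p := by
      intro p hp
      refine (((hasFDerivAt_fst).comp p (hball p hp)).sub (hasFDerivAt_id p)).congr_fderiv ?_
      ext <;> simp [parallelField]
    intro p hp
    have := isOpen_ball.is_const_of_fderiv_eq_zero (𝕜 := 𝕜) (convex_ball p₀ ε).isPreconnected
      (fun q hq => (hd q hq).differentiableAt.differentiableWithinAt)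
      (fun q hq => (hd q hq).fderiv) hp (mem_ball_self hε)
    simpa [hf0, sub_eq_zero] using this
  refine ⟨fun p => (f (p - p₀)).2, by simp [hf0], ?_⟩
  filter_upwards [isOpen_ball.mem_nhds (mem_ball_self hε)] with p hp
  refine ((hasFDerivAt_snd).comp p (hball p hp)).congr_fderiv ?_
  ext v <;> simp [parallelField, hfst p hp]

/-- A flat connection has a parallel frame near each point. -/
theorem exists_parallel_frame {Ω : MatForm 𝕜} (hV : IsOpen V)
    (hΩ : ∀ i j, ContDiffOn 𝕜 ∞ (Ω i j) V) (hflat : IsFlat V Ω) {p₀ : Plane 𝕜} (hp₀ : p₀ ∈ V) :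
    ∃ F : Plane 𝕜 → Matrix (Fin 3) (Fin 3) 𝕜, F p₀ = 1 ∧ ∀ᶠ p in 𝓝 p₀, ∀ i j,
      HasFDerivAt (fun q => F q i j) (∑ k, F p i k • Ω k j p) p := by
  choose f hf0 hf using fun i => exists_parallel_row hV hΩ hflat hp₀
    ((1 : Matrix (Fin 3) (Fin 3) 𝕜) i)
  refine ⟨fun p => Matrix.of fun i => f i p, ?_, ?_⟩
  · ext i j
    simp [hf0]
  · filter_upwards [eventually_all.2 hf] with p hp i j
    exact (hasFDerivAt_pi.1 (hp i)) j

/-- Near each point, a flat connection `Ω_N` linearizes the web: if `F` is a parallel frame, then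
`p ↦ [F(p) (1, 1, 1)]` is a linearization. -/
theorem linearizableNear_of_isFlat {W : Set (Plane 𝕜)} (hW : IsOpen W)
    (hω : IsNormalizedWeb W ω₁ ω₂) {N : Plane 𝕜 → 𝕜} (hN : IsAdmissible N W)
    (hflat : IsFlat W (OmegaN ω₁ ω₂ N)) {p₀ : Plane 𝕜} (hp₀ : p₀ ∈ W) :
    LinearizableNear ω₁ ω₂ p₀ := by
  set Ω := OmegaN ω₁ ω₂ N with hΩdef
  have hΩ : ∀ i j, ContDiffOn 𝕜 ∞ (Ω i j) W := contDiffOn_OmegaN hW hω hN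
  obtain ⟨F, hF0, hF⟩ := exists_parallel_frame hW hΩ hflat hp₀
  have hcont : ∀ i j, ContinuousAt (fun p => F p i j) p₀ := fun i j =>
    ((hF.self_of_nhds) i j).continuousAt
  have hFc : ContinuousAt F p₀ := continuousAt_pi.2 fun i => continuousAt_pi.2 fun j => hcont i j
  have hdet : ∀ᶠ p in 𝓝 p₀, (F p).det ≠ 0 := by
    have h1 : ContinuousAt (fun p => (F p).det) p₀ :=
      (Continuous.matrix_det continuous_id).continuousAt.comp hFc
    exact h1.eventually_ne (by simp [hF0])
  have hZ : ∀ᶠ p in 𝓝 p₀, (F p *ᵥ 1) 2 ≠ 0 := by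
    have h1 : ContinuousAt (fun p => (F p *ᵥ 1) 2) p₀ := by
      simp only [Matrix.mulVec, dotProduct, Pi.one_apply, mul_one]
      exact tendsto_finsetSum _ fun j _ => hcont 2 j
    exact h1.eventually_ne (by simp [hF0])
  obtain ⟨U, hUall, hU, hpU⟩ := _root_.eventually_nhds_iff.1
    (hF.and (hdet.and (hZ.and (hW.mem_nhds hp₀))))
  have hUW : U ⊆ W := fun p hp => (hUall p hp).2.2.2
  have hFU : ∀ p ∈ U, ∀ i j, HasFDerivAt (fun q => F q i j) (∑ k, F p i k • Ω k j p) p :=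
    fun p hp => (hUall p hp).1
  have hdetU : ∀ p ∈ U, (F p).det ≠ 0 := fun p hp => (hUall p hp).2.1
  have hZU : ∀ p ∈ U, (F p *ᵥ 1) 2 ≠ 0 := fun p hp => (hUall p hp).2.2.1
  -- smoothness of the frame
  have hsm : ∀ i j, ContDiffOn 𝕜 ∞ (fun p => F p i j) U := by
    intro i
    have hrow : ContDiffOn 𝕜 ∞ (fun p => (p, F p i)) U := by
      refine contDiffOn_infty_of_hasFDerivAt hU (contDiffOn_parallelField hΩ)
        (fun p hp => ⟨hUW hp, trivial⟩) fun p hp => ?_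
      exact (hasFDerivAt_id p).prodMk (hasFDerivAt_pi.2 fun j => hFU p hp i j)
    intro j
    exact (contDiffOn_pi.1 hrow.snd j)
  have hPsm : ∀ i, ContDiffOn 𝕜 ∞ (fun p => (F p *ᵥ 1) i) U := by
    intro i
    simp only [Matrix.mulVec, dotProduct, Pi.one_apply, mul_one]
    exact ContDiffOn.sum fun j _ => hsm i j
  have hP : ∀ p ∈ U, ∀ i, HasFDerivAt (fun q => (F q *ᵥ 1) i)
      (∑ j, ∑ k, F p i k • Ω k j p) p := by
    intro p hp i
    simp only [Matrix.mulVec, dotProduct, Pi.one_apply, mul_one]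
    exact HasFDerivAt.fun_sum fun j _ => hFU p hp i j
  have hPapply : ∀ p v i, (∑ j, ∑ k, F p i k • Ω k j p) v = (F p *ᵥ (evalForm Ω p v *ᵥ 1)) i := by
    intro p v i
    simp [Matrix.mulVec, dotProduct, evalForm, Fin.sum_univ_three]
    ring
  set φ : Plane 𝕜 → Plane 𝕜 := fun p =>
    ((F p *ᵥ 1) 0 / (F p *ᵥ 1) 2, (F p *ᵥ 1) 1 / (F p *ᵥ 1) 2) with hφ
  have hφsm : ContDiffOn 𝕜 ∞ φ U :=
    ((hPsm 0).div (hPsm 2) hZU).prodMk ((hPsm 1).div (hPsm 2) hZU)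
  have hinj : ∀ p ∈ U, ∀ v, fderiv 𝕜 φ p v = 0 → v = 0 := by
    intro p hp v hv
    set P := F p *ᵥ 1 with hPdef
    set Q := F p *ᵥ (evalForm Ω p v *ᵥ 1) with hQdef
    have hZ0 : P 2 ≠ 0 := hZU p hp
    -- the quotient rule, multiplied out
    have hquot : ∀ i, fderiv 𝕜 (fun q => (F q *ᵥ 1) i / (F q *ᵥ 1) 2) p v = 0 →
        Q i * P 2 = P i * Q 2 := by
      intro i hi
      have h1 := (hP p hp i).mul ((hasDerivAt_inv hZ0).hasFDerivAt.comp p (hP p hp 2))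
      have h2 : fderiv 𝕜 (fun q => (F q *ᵥ 1) i / (F q *ᵥ 1) 2) p v =
          P i * (Q 2 * -(P 2 ^ 2)⁻¹) + (P 2)⁻¹ * Q i := by
        rw [show (fun q => (F q *ᵥ 1) i / (F q *ᵥ 1) 2) =
          (fun q => (F q *ᵥ 1) i) * ((fun x => x⁻¹) ∘ fun q => (F q *ᵥ 1) 2) from
            funext fun q => div_eq_mul_inv _ _, h1.fderiv]
        simp only [add_apply, smul_apply, hPapply, smul_eq_mul,
          ContinuousLinearMap.comp_apply, ContinuousLinearMap.toSpanSingleton_apply,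
          Function.comp_apply]
        rfl
      rw [h2] at hi
      field_simp at hi
      linear_combination hi
    have hsplit : fderiv 𝕜 φ p v = (fderiv 𝕜 (fun q => (F q *ᵥ 1) 0 / (F q *ᵥ 1) 2) p v,
        fderiv 𝕜 (fun q => (F q *ᵥ 1) 1 / (F q *ᵥ 1) 2) p v) := by
      have hd : ∀ i, DifferentiableAt 𝕜 (fun q => (F q *ᵥ 1) i / (F q *ᵥ 1) 2) p := fun i =>
        differentiableAt_of_contDiffOn hU ((hPsm i).div (hPsm 2) hZU) hp
      rw [hφ, (hd 0).fderiv_prodMk (hd 1)]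
      rfl
    rw [hsplit] at hv
    have h0 := hquot 0 (congrArg Prod.fst hv)
    have h1 := hquot 1 (congrArg Prod.snd hv)
    have hall : ∀ i, Q i * P 2 = P i * Q 2 := by
      intro i
      fin_cases i
      exacts [h0, h1, mul_comm _ _]
    -- hence `Ω(v) (1, 1, 1)` is a multiple of `(1, 1, 1)`
    have hQP : F p *ᵥ (evalForm Ω p v *ᵥ 1 - (Q 2 / P 2) • 1) = 0 := by
      rw [Matrix.mulVec_sub, Matrix.mulVec_smul, ← hPdef, ← hQdef]
      ext i
      have : Q i = Q 2 / P 2 * P i := by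
        field_simp
        linear_combination hall i
      simpa [sub_eq_zero] using this
    have hz := Matrix.eq_zero_of_mulVec_eq_zero (hdetU p hp) hQP
    obtain ⟨l, hl⟩ := evalForm_OmegaN_mulVec_one (ω₁ := ω₁) (ω₂ := ω₂) N p v
    rw [hl] at hz
    have e0 := congrFun hz 0
    have e1 := congrFun hz 1
    have e2 := congrFun hz 2
    simp [Matrix.vecHead, Matrix.vecTail] at e0 e1 e2
    have hN0 := hN.2 p (hUW hp)
    have i1 : ω₁ p v = 0 := by
      have : (N p)⁻¹ * ω₁ p v = 0 := by linear_combination e1 - e2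
      exact (mul_eq_zero.1 this).resolve_left (inv_ne_zero hN0)
    have i2 : ω₂ p v = 0 := by
      have : (N p)⁻¹ * ω₂ p v = 0 := by linear_combination e2 - e0
      exact (mul_eq_zero.1 this).resolve_left (inv_ne_zero hN0)
    rw [eq_frame_combination (hω.independent p (hUW hp)) v, i1, i2, zero_smul, zero_smul, sub_zero]
  have hstr : ∀ (θ : OneForm 𝕜) (i : Fin 3),
      (∀ p v, θ p v = 0 → PreservesFlag i (evalForm Ω p v)) → Straightens θ U φ := by
    intro θ i hfl s₀ r c hc
    have hcW : IsLeafArc θ W s₀ r c := ⟨hc.1, fun s hs => ⟨hUW (hc.2 s hs).1, (hc.2 s hs).2⟩⟩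
    obtain ⟨ℓ, hℓ, hline⟩ := exists_line_of_preservesFlag (R := fun s => F (c s)) i
      (differentiableOn_evalForm_arc hΩ hcW) (fun s hs => hfl _ _ (hc.2 s hs).2.2)
      (fun s hs j k => by
        have hcs : HasDerivAt c (deriv c s) s :=
          ((hc.1.contDiffAt (isOpen_ball.mem_nhds hs)).differentiableAt (by simp)).hasDerivAt
        refine ((hFU _ (hc.2 s hs).1 j k).comp_hasDerivAt s hcs).congr_deriv ?_
        simp [Matrix.mul_apply, evalForm])
    by_cases hne : (ball s₀ r).Nonempty
    · have hdiv : ∀ s ∈ ball s₀ r, ℓ 0 * (φ (c s)).1 + ℓ 1 * (φ (c s)).2 + ℓ 2 = 0 := by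
        intro s hs
        have h1 := hline s hs
        have hZ0 := hZU _ (hc.2 s hs).1
        simp only [dotProduct, Fin.sum_univ_three] at h1
        simp only [hφ]
        field_simp
        linear_combination h1
      refine collinear_of_affine_equation (a := ℓ 0) (b := ℓ 1) (c := ℓ 2) ?_ ?_
      · by_contra! h0
        obtain ⟨s, hs⟩ := hne
        have h2 := hdiv s hs
        rw [h0.1, h0.2, zero_mul, zero_mul, zero_add, zero_add] at h2
        refine hℓ (funext fun i => ?_)
        fin_cases i
        · exact h0.1
        · exact h0.2
        · exact h2
      · rintro _ ⟨s, hs, rfl⟩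
        exact hdiv s hs
    · rw [not_nonempty_iff_eq_empty.1 hne, image_empty]
      exact collinear_empty 𝕜 _
  exact ⟨U, hU, hpU, φ, isLocalDiffeomorphOn_of_fderiv_injective hU hφsm hinj,
    hstr _ 0 fun _ _ h => preservesFlag_leaf₁ N h, hstr _ 1 fun _ _ h => preservesFlag_leaf₂ N h,
    hstr _ 2 fun _ _ h => preservesFlag_leaf₃ N h⟩

/-! ### The second-order equations of a linearization -/

theorem exists_integral_arc (hV : IsOpen V) {X : Plane 𝕜 → Plane 𝕜} (hX : ContDiffOn 𝕜 ∞ X V)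
    {q : Plane 𝕜} (hq : q ∈ V) : ∃ r > 0, ∃ c : 𝕜 → Plane 𝕜, c 0 = q ∧
      ContDiffOn 𝕜 ∞ c (ball 0 r) ∧ ∀ s ∈ ball (0 : 𝕜) r, c s ∈ V ∧ HasDerivAt c (X (c s)) s := by
  set A : Plane 𝕜 → 𝕜 →L[𝕜] Plane 𝕜 := fun p => ContinuousLinearMap.toSpanSingleton 𝕜 (X p)
  have hA : ContDiffOn 𝕜 ∞ A V := by
    rw [contDiffOn_clm_apply]
    intro t
    exact (contDiffOn_const (c := t)).smul hX
  obtain ⟨c, hc0, hc⟩ := exists_hasFDerivAt_of_commuting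
    ((hA.contDiffAt (hV.mem_nhds hq)).of_le (m := 2) ENat.LEInfty.out)
    (Eventually.of_forall fun p s t => by
      -- in one variable the commutation holds by linearity
      have h1 : ∀ s : 𝕜, A p s = s • A p 1 := fun s => by simp [A]
      rw [h1 s, h1 t, map_smul, map_smul]
      have h2 : ∀ (L : 𝕜 →L[𝕜] Plane 𝕜) (s : 𝕜), L s = s • L 1 := fun L s => by
        rw [← map_smul, smul_eq_mul, mul_one]
      simp only [smul_apply]
      rw [h2 _ t, h2 _ s, smul_comm])
  have hcV : ∀ᶠ s in 𝓝 (0 : 𝕜), c s ∈ V :=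
    hc.self_of_nhds.continuousAt (by rw [hc0]; exact hV.mem_nhds hq)
  obtain ⟨r, hr, hball⟩ := Metric.eventually_nhds_iff_ball.1 (hc.and hcV)
  refine ⟨r, hr, c, hc0, contDiffOn_infty_of_hasFDerivAt isOpen_ball hA
    (fun s hs => (hball s hs).2) fun s hs => (hball s hs).1, fun s hs => ⟨(hball s hs).2, ?_⟩⟩
  simpa [A, hasDerivAt_iff_hasFDerivAt] using (hball s hs).1

/-- If `φ = (x, y)` maps the integral curves of `X` into lines, then `X X φ` is proportional
to `X φ`. -/
theorem Straightens.second_derivative {θ : OneForm 𝕜} {φ : Plane 𝕜 → Plane 𝕜} (hV : IsOpen V)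
    (hφ : ContDiffOn 𝕜 ∞ φ V) (hstr : Straightens θ V φ) {X : Plane 𝕜 → Plane 𝕜}
    (hX : ContDiffOn 𝕜 ∞ X V) (hX0 : ∀ p ∈ V, X p ≠ 0) (hθ : ∀ p ∈ V, θ p (X p) = 0)
    {q : Plane 𝕜} (hq : q ∈ V) :
    fderiv 𝕜 (fun p => fderiv 𝕜 (fun z => (φ z).1) p (X p)) q (X q) *
        fderiv 𝕜 (fun z => (φ z).2) q (X q) =
      fderiv 𝕜 (fun p => fderiv 𝕜 (fun z => (φ z).2) p (X p)) q (X q) *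
        fderiv 𝕜 (fun z => (φ z).1) q (X q) := by
  obtain ⟨r, hr, c, hc0, hc, hcX⟩ := exists_integral_arc hV hX hq
  obtain ⟨a, b, k, hab, hline⟩ := exists_affine_equation_of_collinear
    (hstr 0 r c ⟨hc, fun s hs => by
      rw [(hcX s hs).2.deriv]
      exact ⟨(hcX s hs).1, hX0 _ (hcX s hs).1, hθ _ (hcX s hs).1⟩⟩)
  have h0 : (0 : 𝕜) ∈ ball (0 : 𝕜) r := mem_ball_self hr
  have hder : ∀ {f : Plane 𝕜 → 𝕜}, ContDiffOn 𝕜 ∞ f V → ∀ s ∈ ball (0 : 𝕜) r,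
      HasDerivAt (fun t => f (c t)) (fderiv 𝕜 f (c s) (X (c s))) s := fun hf s hs =>
    (differentiableAt_of_contDiffOn hV hf (hcX s hs).1).hasFDerivAt.comp_hasDerivAt s (hcX s hs).2
  -- an affine relation along the arc can be differentiated
  have hrel : ∀ {f g : Plane 𝕜 → 𝕜} {m : 𝕜}, ContDiffOn 𝕜 ∞ f V → ContDiffOn 𝕜 ∞ g V →
      (∀ s ∈ ball (0 : 𝕜) r, a * f (c s) + b * g (c s) + m = 0) → ∀ s ∈ ball (0 : 𝕜) r,
        a * fderiv 𝕜 f (c s) (X (c s)) + b * fderiv 𝕜 g (c s) (X (c s)) + 0 = 0 := by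
    intro f g m hf hg h s hs
    have h1 := (((hder hf s hs).const_mul a).add ((hder hg s hs).const_mul b)).add_const m
    have h2 : (fun t => a * f (c t) + b * g (c t) + m) =ᶠ[𝓝 s] fun _ => 0 := by
      filter_upwards [isOpen_ball.mem_nhds hs] with t ht using h t ht
    rw [add_zero]
    exact h1.unique ((hasDerivAt_const s (0 : 𝕜)).congr_of_eventuallyEq h2)
  have hx : ContDiffOn 𝕜 ∞ (fun z => (φ z).1) V := hφ.fst
  have hy : ContDiffOn 𝕜 ∞ (fun z => (φ z).2) V := hφ.snd
  have hr1 := hrel hx hy fun s hs => hline _ ⟨s, hs, rfl⟩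
  have hr2 := hrel ((contDiffOn_fderiv hV hx).clm_apply hX) ((contDiffOn_fderiv hV hy).clm_apply hX)
    hr1 0 h0
  have hr1 := hr1 0 h0
  rw [hc0] at hr1 hr2
  rcases hab with h | h
  · refine mul_left_cancel₀ h ?_
    linear_combination fderiv 𝕜 (fun z => (φ z).2) q (X q) * hr2 -
      fderiv 𝕜 (fun p => fderiv 𝕜 (fun z => (φ z).2) p (X p)) q (X q) * hr1
  · refine mul_left_cancel₀ h ?_
    linear_combination fderiv 𝕜 (fun p => fderiv 𝕜 (fun z => (φ z).1) p (X p)) q (X q) * hr1 -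
      fderiv 𝕜 (fun z => (φ z).1) q (X q) * hr2

/-- The second-order linear system satisfied by the affine coordinates of a linearization. -/
structure SolvesLinearSystem (ω₁ ω₂ : OneForm 𝕜) (V : Set (Plane 𝕜)) (B C g f : Plane 𝕜 → 𝕜) :
    Prop where
  smooth : ContDiffOn 𝕜 ∞ f V
  eq₁₁ : ∀ p ∈ V, D₁ ω₁ ω₂ (D₁ ω₁ ω₂ f) p = (g p + 2 * B p - alpha ω₁ ω₂ p) * D₁ ω₁ ω₂ f p
  eq₁₂ : ∀ p ∈ V, D₂ ω₁ ω₂ (D₁ ω₁ ω₂ f) p =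
    (C p - beta ω₁ ω₂ p) * D₁ ω₁ ω₂ f p + B p * D₂ ω₁ ω₂ f p
  eq₂₁ : ∀ p ∈ V, D₁ ω₁ ω₂ (D₂ ω₁ ω₂ f) p =
    C p * D₁ ω₁ ω₂ f p + (B p - alpha ω₁ ω₂ p) * D₂ ω₁ ω₂ f p
  eq₂₂ : ∀ p ∈ V, D₂ ω₁ ω₂ (D₂ ω₁ ω₂ f) p = (g p + 2 * C p - beta ω₁ ω₂ p) * D₂ ω₁ ω₂ f p

/-- The Jacobian of `(x, y)` in the frame of the web. -/
def jac (ω₁ ω₂ : OneForm 𝕜) (x y : Plane 𝕜 → 𝕜) (p : Plane 𝕜) : 𝕜 :=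
  D₁ ω₁ ω₂ x p * D₂ ω₁ ω₂ y p - D₂ ω₁ ω₂ x p * D₁ ω₁ ω₂ y p

/-- The affine coordinates `x`, `y` of a linearization satisfy a common linear system. The
coefficients come from Cramer's rule; the straightness of the third family of leaves forces the same
`g` in the equations for `f₁₁` and `f₂₂`. -/
theorem exists_linear_system (hV : IsOpen V) (hω : IsNormalizedWeb V ω₁ ω₂)
    {φ : Plane 𝕜 → Plane 𝕜} (hφ : IsLinearization ω₁ ω₂ V φ) :
    ∃ B C g x y : Plane 𝕜 → 𝕜, ContDiffOn 𝕜 ∞ B V ∧ ContDiffOn 𝕜 ∞ C V ∧ ContDiffOn 𝕜 ∞ g V ∧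
      SolvesLinearSystem ω₁ ω₂ V B C g x ∧ SolvesLinearSystem ω₁ ω₂ V B C g y ∧
      ∀ p ∈ V, jac ω₁ ω₂ x y p ≠ 0 := by
  obtain ⟨hloc, hs1, hs2, hs3⟩ := hφ
  have hsm : ContDiffOn 𝕜 ∞ φ V := hloc.contMDiffOn.contDiffOn
  set x : Plane 𝕜 → 𝕜 := fun z => (φ z).1 with hxdef
  set y : Plane 𝕜 → 𝕜 := fun z => (φ z).2 with hydef
  have hx : ContDiffOn 𝕜 ∞ x V := hsm.fst
  have hy : ContDiffOn 𝕜 ∞ y V := hsm.snd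
  have hx1 := contDiffOn_D₁ hV hω hx
  have hx2 := contDiffOn_D₂ hV hω hx
  have hy1 := contDiffOn_D₁ hV hω hy
  have hy2 := contDiffOn_D₂ hV hω hy
  have hf1 := contDiffOn_frame₁ hω
  have hf2 := contDiffOn_frame₂ hω
  have hJ : ∀ p ∈ V, jac ω₁ ω₂ x y p ≠ 0 := by
    intro p hp h0
    have hdφ : ∀ v, fderiv 𝕜 φ p v = (fderiv 𝕜 x p v, fderiv 𝕜 y p v) := by
      intro v
      have := (differentiableAt_of_contDiffOn hV hx hp).fderiv_prodMk
        (differentiableAt_of_contDiffOn hV hy hp)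
      exact congrArg (fun L => L v) this
    have hker : ∀ s t : 𝕜, s * D₁ ω₁ ω₂ x p + t * D₂ ω₁ ω₂ x p = 0 →
        s * D₁ ω₁ ω₂ y p + t * D₂ ω₁ ω₂ y p = 0 → s = 0 ∧ t = 0 := by
      intro s t h1 h2
      have hw := hω.independent p hp
      have h3 : s • frame₁ ω₁ ω₂ p + t • frame₂ ω₁ ω₂ p = 0 := by
        refine fderiv_injective_of_isLocalDiffeomorphOn hloc hp ?_
        rw [hdφ, map_add, map_add, map_smul, map_smul, map_smul, map_smul, ← D₁_eq_fderiv_frame,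
          ← D₁_eq_fderiv_frame, ← D₂_eq_fderiv_frame, ← D₂_eq_fderiv_frame]
        exact Prod.ext h1 h2
      have h4 := congrArg (ω₁ p) h3
      have h5 := congrArg (ω₂ p) h3
      rw [map_add, map_smul, map_smul, form₁_frame₁, form₁_frame₂ hw, map_zero] at h4
      rw [map_add, map_smul, map_smul, form₂_frame₂, form₂_frame₁ hw, map_zero] at h5
      simp at h4 h5
      exact ⟨h5, h4⟩
    unfold jac at h0
    have k1 := hker (D₂ ω₁ ω₂ x p) (-D₁ ω₁ ω₂ x p) (by ring) (by linear_combination -h0)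
    have k2 := hker (D₂ ω₁ ω₂ y p) (-D₁ ω₁ ω₂ y p) (by linear_combination h0) (by ring)
    have k3 := hker 1 0 (by simpa using k1.2) (by simpa using k2.2)
    exact one_ne_zero k3.1
  have hJsm : ContDiffOn 𝕜 ∞ (jac ω₁ ω₂ x y) V := (hx1.mul hy2).sub (hx2.mul hy1)
  -- the three families of leaves
  have hc1 : ∀ p ∈ V, D₁ ω₁ ω₂ (D₁ ω₁ ω₂ x) p * D₁ ω₁ ω₂ y p =
      D₁ ω₁ ω₂ (D₁ ω₁ ω₂ y) p * D₁ ω₁ ω₂ x p := by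
    intro p hp
    have h := hs1.second_derivative hV hsm hf1 (fun p hp h0 => by
      have := form₂_frame₁ (hω.independent p hp)
      rw [h0, map_zero] at this
      simp at this) (fun p _ => form₁_frame₁) hp
    simp only [← D₁_eq_fderiv_frame] at h
    exact h
  have hc2 : ∀ p ∈ V, D₂ ω₁ ω₂ (D₂ ω₁ ω₂ x) p * D₂ ω₁ ω₂ y p =
      D₂ ω₁ ω₂ (D₂ ω₁ ω₂ y) p * D₂ ω₁ ω₂ x p := by
    intro p hp
    have h := hs2.second_derivative hV hsm hf2 (fun p hp h0 => by
      have := form₁_frame₂ (hω.independent p hp)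
      rw [h0, map_zero] at this
      simp at this) (fun p _ => form₂_frame₂) hp
    simp only [← D₂_eq_fderiv_frame] at h
    exact h
  have hc3 : ∀ p ∈ V, (D₁ ω₁ ω₂ (D₁ ω₁ ω₂ x) p + D₂ ω₁ ω₂ (D₁ ω₁ ω₂ x) p +
        D₁ ω₁ ω₂ (D₂ ω₁ ω₂ x) p + D₂ ω₁ ω₂ (D₂ ω₁ ω₂ x) p) *
          (D₁ ω₁ ω₂ y p + D₂ ω₁ ω₂ y p) =
      (D₁ ω₁ ω₂ (D₁ ω₁ ω₂ y) p + D₂ ω₁ ω₂ (D₁ ω₁ ω₂ y) p +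
        D₁ ω₁ ω₂ (D₂ ω₁ ω₂ y) p + D₂ ω₁ ω₂ (D₂ ω₁ ω₂ y) p) *
          (D₁ ω₁ ω₂ x p + D₂ ω₁ ω₂ x p) := by
    intro p hp
    have h := hs3.second_derivative hV hsm (hf1.add hf2) (fun p hp h0 => by
      have := congrArg (ω₁ p) h0
      rw [map_add, form₁_frame₁, form₁_frame₂ (hω.independent p hp), map_zero] at this
      simp at this) (fun p hp => by
      change -(ω₁ p (frame₁ ω₁ ω₂ p + frame₂ ω₁ ω₂ p) + ω₂ p (frame₁ ω₁ ω₂ p + frame₂ ω₁ ω₂ p)) = 0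
      rw [map_add, map_add, form₁_frame₁, form₁_frame₂ (hω.independent p hp), form₂_frame₂,
        form₂_frame₁ (hω.independent p hp)]
      simp) hp
    have hD : ∀ (f : Plane 𝕜 → 𝕜) (p : Plane 𝕜),
        fderiv 𝕜 f p (frame₁ ω₁ ω₂ p + frame₂ ω₁ ω₂ p) = D₁ ω₁ ω₂ f p + D₂ ω₁ ω₂ f p := by
      intro f p
      rw [map_add, ← D₁_eq_fderiv_frame, ← D₂_eq_fderiv_frame]
    simp only [hD] at h
    have hX := (hasFrameDerivAt_of_contDiffOn (ω₁ := ω₁) (ω₂ := ω₂) hV hx1 hp).add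
      (hasFrameDerivAt_of_contDiffOn hV hx2 hp)
    have hY := (hasFrameDerivAt_of_contDiffOn (ω₁ := ω₁) (ω₂ := ω₂) hV hy1 hp).add
      (hasFrameDerivAt_of_contDiffOn hV hy2 hp)
    rw [hX.D₁_eq, hX.D₂_eq, hY.D₁_eq, hY.D₂_eq] at h
    linear_combination h
  have hx11 := contDiffOn_D₁ hV hω hx1
  have hx12 := contDiffOn_D₂ hV hω hx1
  have hx21 := contDiffOn_D₁ hV hω hx2
  have hy11 := contDiffOn_D₁ hV hω hy1
  have hy12 := contDiffOn_D₂ hV hω hy1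
  have hy21 := contDiffOn_D₁ hV hω hy2
  -- Cramer's rule for the coefficients
  set B : Plane 𝕜 → 𝕜 := fun p => (D₁ ω₁ ω₂ x p * D₂ ω₁ ω₂ (D₁ ω₁ ω₂ y) p -
    D₁ ω₁ ω₂ y p * D₂ ω₁ ω₂ (D₁ ω₁ ω₂ x) p) / jac ω₁ ω₂ x y p with hB
  set C : Plane 𝕜 → 𝕜 := fun p => (D₁ ω₁ ω₂ (D₂ ω₁ ω₂ x) p * D₂ ω₁ ω₂ y p -
    D₁ ω₁ ω₂ (D₂ ω₁ ω₂ y) p * D₂ ω₁ ω₂ x p) / jac ω₁ ω₂ x y p with hC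
  set k : Plane 𝕜 → 𝕜 := fun p => (D₁ ω₁ ω₂ (D₁ ω₁ ω₂ x) p * D₂ ω₁ ω₂ y p -
    D₁ ω₁ ω₂ (D₁ ω₁ ω₂ y) p * D₂ ω₁ ω₂ x p) / jac ω₁ ω₂ x y p with hk
  set g : Plane 𝕜 → 𝕜 := fun p => k p - 2 * B p + alpha ω₁ ω₂ p with hg
  have hBsm : ContDiffOn 𝕜 ∞ B V := ((hx1.mul hy12).sub (hy1.mul hx12)).div hJsm hJ
  have hCsm : ContDiffOn 𝕜 ∞ C V := ((hx21.mul hy2).sub (hy21.mul hx2)).div hJsm hJ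
  have hksm : ContDiffOn 𝕜 ∞ k V := ((hx11.mul hy2).sub (hy11.mul hx2)).div hJsm hJ
  have hgsm : ContDiffOn 𝕜 ∞ g V :=
    (hksm.sub (contDiffOn_const.mul hBsm)).add (contDiffOn_alpha hV hω)
  have hBJ : ∀ p ∈ V, B p * jac ω₁ ω₂ x y p = D₁ ω₁ ω₂ x p * D₂ ω₁ ω₂ (D₁ ω₁ ω₂ y) p -
    D₁ ω₁ ω₂ y p * D₂ ω₁ ω₂ (D₁ ω₁ ω₂ x) p := fun p hp => div_mul_cancel₀ _ (hJ p hp)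
  have hCJ : ∀ p ∈ V, C p * jac ω₁ ω₂ x y p = D₁ ω₁ ω₂ (D₂ ω₁ ω₂ x) p * D₂ ω₁ ω₂ y p -
    D₁ ω₁ ω₂ (D₂ ω₁ ω₂ y) p * D₂ ω₁ ω₂ x p := fun p hp => div_mul_cancel₀ _ (hJ p hp)
  have hkJ : ∀ p ∈ V, k p * jac ω₁ ω₂ x y p = D₁ ω₁ ω₂ (D₁ ω₁ ω₂ x) p * D₂ ω₁ ω₂ y p -
    D₁ ω₁ ω₂ (D₁ ω₁ ω₂ y) p * D₂ ω₁ ω₂ x p := fun p hp => div_mul_cancel₀ _ (hJ p hp)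
  refine ⟨B, C, g, x, y, hBsm, hCsm, hgsm, ⟨hx, fun p hp => ?_, fun p hp => ?_, fun p hp => ?_,
    fun p hp => ?_⟩, ⟨hy, fun p hp => ?_, fun p hp => ?_, fun p hp => ?_, fun p hp => ?_⟩, hJ⟩
  all_goals
    have ex := D_commutator hV hω hx hp
    have ey := D_commutator hV hω hy hp
    have e1 := hc1 p hp
    have e2 := hc2 p hp
    have e3 := hc3 p hp
    have eB := hBJ p hp
    have eC := hCJ p hp
    have ek := hkJ p hp
    have hJ0 := hJ p hp
    simp only [jac] at eB eC ek hJ0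
    set x₁ := D₁ ω₁ ω₂ x p
    set x₂ := D₂ ω₁ ω₂ x p
    set y₁ := D₁ ω₁ ω₂ y p
    set y₂ := D₂ ω₁ ω₂ y p
    have eg : g p = k p - 2 * B p + alpha ω₁ ω₂ p := rfl
    refine mul_right_cancel₀ hJ0 ?_
    try rw [eg]
  · linear_combination -x₁ * ek - x₂ * e1
  · linear_combination -x₁ * eC - x₂ * eB - x₁ * y₂ * ex + x₁ * x₂ * ey
  · linear_combination -x₁ * eC - x₂ * eB - x₂ * y₁ * ex + x₂ * x₁ * ey
  · linear_combination -x₂ * (ek - 2 * eB + 2 * eC) + x₁ * e2 - x₂ * (e3 - e1 - e2) -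
      x₂ * ((x₁ - x₂) * ey - (y₁ - y₂) * ex)
  · linear_combination -y₁ * ek - y₂ * e1
  · linear_combination -y₁ * eC - y₂ * eB - y₁ * y₂ * ex + y₁ * x₂ * ey
  · linear_combination -y₁ * eC - y₂ * eB - y₂ * y₁ * ex + y₂ * x₁ * ey
  · linear_combination -y₂ * (ek - 2 * eB + 2 * eC) + y₁ * e2 - y₂ * (e3 - e1 - e2) -
      y₂ * ((x₁ - x₂) * ey - (y₁ - y₂) * ex)

/-! ### Integrability of the linear system -/

theorem HasFrameDerivAt.congr_of_eqOn {f h : Plane 𝕜 → 𝕜} {a b : 𝕜} {p : Plane 𝕜}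
    (hf : HasFrameDerivAt ω₁ ω₂ f a b p) (hV : IsOpen V) (hp : p ∈ V) (he : ∀ q ∈ V, h q = f q) :
    HasFrameDerivAt ω₁ ω₂ h a b p :=
  hf.congr_of_eventuallyEq (by filter_upwards [hV.mem_nhds hp] using he)

/-- A linear relation between the frame derivatives of `x` and `y` is trivial. -/
theorem eq_zero_of_jac_ne_zero {x y : Plane 𝕜 → 𝕜} {p : Plane 𝕜} (hJ : jac ω₁ ω₂ x y p ≠ 0)
    {a b : 𝕜} (hx : a * D₁ ω₁ ω₂ x p + b * D₂ ω₁ ω₂ x p = 0)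
    (hy : a * D₁ ω₁ ω₂ y p + b * D₂ ω₁ ω₂ y p = 0) : a = 0 ∧ b = 0 := by
  unfold jac at hJ
  constructor
  · refine (mul_eq_zero.1 (?_ : a * _ = 0)).resolve_right hJ
    linear_combination D₂ ω₁ ω₂ y p * hx - D₂ ω₁ ω₂ x p * hy
  · refine (mul_eq_zero.1 (?_ : b * _ = 0)).resolve_right hJ
    linear_combination D₁ ω₁ ω₂ x p * hy - D₁ ω₁ ω₂ y p * hx

/-- The integrability conditions of the linear system, in terms of `X = C₁ - C B + α C` and
`Y = C B - β B - B₂`. The functions `B` and `C` no longer occur, and `X`, `Y` are taken as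
unknowns. -/
structure IntegrabilityEquations (ω₁ ω₂ : OneForm 𝕜) (V : Set (Plane 𝕜))
    (g X Y : Plane 𝕜 → 𝕜) : Prop where
  smooth_g : ContDiffOn 𝕜 ∞ g V
  smooth_X : ContDiffOn 𝕜 ∞ X V
  smooth_Y : ContDiffOn 𝕜 ∞ Y V
  g₁ : ∀ p ∈ V, D₁ ω₁ ω₂ g p = 1 - alpha ω₁ ω₂ p * g p - 2 * X p - Y p
  g₂ : ∀ p ∈ V, D₂ ω₁ ω₂ g p = -1 - beta ω₁ ω₂ p * g p + X p + 2 * Y p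
  X₂ : ∀ p ∈ V, D₂ ω₁ ω₂ X p = (g p - 2 * beta ω₁ ω₂ p) * X p
  Y₁ : ∀ p ∈ V, D₁ ω₁ ω₂ Y p = (g p - 2 * alpha ω₁ ω₂ p) * Y p

theorem IntegrabilityEquations.mono {W : Set (Plane 𝕜)} {g X Y : Plane 𝕜 → 𝕜}
    (h : IntegrabilityEquations ω₁ ω₂ V g X Y) (hW : W ⊆ V) :
    IntegrabilityEquations ω₁ ω₂ W g X Y :=
  ⟨h.smooth_g.mono hW, h.smooth_X.mono hW, h.smooth_Y.mono hW, fun p hp => h.g₁ p (hW hp),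
    fun p hp => h.g₂ p (hW hp), fun p hp => h.X₂ p (hW hp), fun p hp => h.Y₁ p (hW hp)⟩

/-- The coefficients of the linear system are differentiated until they close up: compatibility of
the third derivatives of `x` and `y` gives `B₁`, `C₂`, `g₁` and `g₂`, then that of the second
derivatives of `B` and `C` gives `Y₁` and `X₂`. -/
theorem exists_integrabilityEquations (hV : IsOpen V) (hω : IsNormalizedWeb V ω₁ ω₂)
    {B C g x y : Plane 𝕜 → 𝕜} (hB : ContDiffOn 𝕜 ∞ B V) (hC : ContDiffOn 𝕜 ∞ C V)
    (hg : ContDiffOn 𝕜 ∞ g V) (hx : SolvesLinearSystem ω₁ ω₂ V B C g x)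
    (hy : SolvesLinearSystem ω₁ ω₂ V B C g y) (hJ : ∀ p ∈ V, jac ω₁ ω₂ x y p ≠ 0) :
    ∃ X Y : Plane 𝕜 → 𝕜, IntegrabilityEquations ω₁ ω₂ V g X Y := by
  have hα := contDiffOn_alpha hV hω
  have hβ := contDiffOn_beta hV hω
  have hd : ∀ {f : Plane 𝕜 → 𝕜}, ContDiffOn 𝕜 ∞ f V → ∀ p ∈ V,
      HasFrameDerivAt ω₁ ω₂ f (D₁ ω₁ ω₂ f p) (D₂ ω₁ ω₂ f p) p :=
    fun hf p hp => hasFrameDerivAt_of_contDiffOn hV hf hp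
  -- the compatibility of the third derivatives of a solution
  have key : ∀ f, SolvesLinearSystem ω₁ ω₂ V B C g f → ∀ p ∈ V,
      (D₁ ω₁ ω₂ C p - D₁ ω₁ ω₂ (beta ω₁ ω₂) p + B p * C p - D₂ ω₁ ω₂ g p - 2 * D₂ ω₁ ω₂ B p +
          D₂ ω₁ ω₂ (alpha ω₁ ω₂) p + alpha ω₁ ω₂ p * (C p - beta ω₁ ω₂ p) -
          beta ω₁ ω₂ p * (g p + 2 * B p - alpha ω₁ ω₂ p)) * D₁ ω₁ ω₂ f p +
        (D₁ ω₁ ω₂ B p - B p ^ 2 - g p * B p + alpha ω₁ ω₂ p * B p) * D₂ ω₁ ω₂ f p = 0 ∧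
      (C p ^ 2 + g p * C p - beta ω₁ ω₂ p * C p - D₂ ω₁ ω₂ C p) * D₁ ω₁ ω₂ f p +
        (D₁ ω₁ ω₂ g p + 2 * D₁ ω₁ ω₂ C p - D₁ ω₁ ω₂ (beta ω₁ ω₂) p - C p * B p -
          D₂ ω₁ ω₂ B p + D₂ ω₁ ω₂ (alpha ω₁ ω₂) p +
          alpha ω₁ ω₂ p * (g p + 2 * C p - beta ω₁ ω₂ p) -
          beta ω₁ ω₂ p * (B p - alpha ω₁ ω₂ p)) * D₂ ω₁ ω₂ f p = 0 := by
    intro f hf p hp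
    have h1 := contDiffOn_D₁ hV hω hf.smooth
    have h2 := contDiffOn_D₂ hV hω hf.smooth
    have k1 := D_commutator hV hω h1 hp
    have k2 := D_commutator hV hω h2 hp
    have d11 := ((((hd hg p hp).add ((hd hB p hp).const_mul 2)).sub (hd hα p hp)).mul
      (hd h1 p hp)).congr_of_eqOn hV hp hf.eq₁₁
    have d12 := ((((hd hC p hp).sub (hd hβ p hp)).mul (hd h1 p hp)).add
      ((hd hB p hp).mul (hd h2 p hp))).congr_of_eqOn hV hp hf.eq₁₂
    have d21 := (((hd hC p hp).mul (hd h1 p hp)).add (((hd hB p hp).sub (hd hα p hp)).mul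
      (hd h2 p hp))).congr_of_eqOn hV hp hf.eq₂₁
    have d22 := ((((hd hg p hp).add ((hd hC p hp).const_mul 2)).sub (hd hβ p hp)).mul
      (hd h2 p hp)).congr_of_eqOn hV hp hf.eq₂₂
    rw [d12.D₁_eq, d11.D₂_eq, hf.eq₁₁ p hp, hf.eq₁₂ p hp, hf.eq₂₁ p hp] at k1
    rw [d22.D₁_eq, d21.D₂_eq, hf.eq₁₂ p hp, hf.eq₂₁ p hp, hf.eq₂₂ p hp] at k2
    exact ⟨by linear_combination k1, by linear_combination k2⟩
  have hB1 : ∀ p ∈ V, D₁ ω₁ ω₂ B p = B p ^ 2 + g p * B p - alpha ω₁ ω₂ p * B p := by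
    intro p hp
    have h := (eq_zero_of_jac_ne_zero (hJ p hp) (key x hx p hp).1 (key y hy p hp).1).2
    linear_combination h
  have hC2 : ∀ p ∈ V, D₂ ω₁ ω₂ C p = C p ^ 2 + g p * C p - beta ω₁ ω₂ p * C p := by
    intro p hp
    have h := (eq_zero_of_jac_ne_zero (hJ p hp) (key x hx p hp).2 (key y hy p hp).2).1
    linear_combination -h
  have hB2s := contDiffOn_D₂ hV hω hB
  have hC1s := contDiffOn_D₁ hV hω hC
  set X : Plane 𝕜 → 𝕜 := fun p => D₁ ω₁ ω₂ C p - C p * B p + alpha ω₁ ω₂ p * C p with hX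
  set Y : Plane 𝕜 → 𝕜 := fun p => C p * B p - beta ω₁ ω₂ p * B p - D₂ ω₁ ω₂ B p with hY
  have hXs : ContDiffOn 𝕜 ∞ X V := (hC1s.sub (hC.mul hB)).add (hα.mul hC)
  have hYs : ContDiffOn 𝕜 ∞ Y V := ((hC.mul hB).sub (hβ.mul hB)).sub hB2s
  have hg1 : ∀ p ∈ V, D₁ ω₁ ω₂ g p = 1 - alpha ω₁ ω₂ p * g p - 2 * X p - Y p := by
    intro p hp
    have h := (eq_zero_of_jac_ne_zero (hJ p hp) (key x hx p hp).2 (key y hy p hp).2).2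
    simp only [hX, hY]
    linear_combination h + D₁_beta hV hω hp
  have hg2 : ∀ p ∈ V, D₂ ω₁ ω₂ g p = -1 - beta ω₁ ω₂ p * g p + X p + 2 * Y p := by
    intro p hp
    have h := (eq_zero_of_jac_ne_zero (hJ p hp) (key x hx p hp).1 (key y hy p hp).1).1
    simp only [hX, hY]
    linear_combination -h - D₁_beta hV hω hp
  refine ⟨X, Y, hg, hXs, hYs, hg1, hg2, fun p hp => ?_, fun p hp => ?_⟩
  · have k := D_commutator hV hω hC hp
    have d2 := ((((hd hC p hp).mul (hd hC p hp)).add ((hd hg p hp).mul (hd hC p hp))).sub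
      ((hd hβ p hp).mul (hd hC p hp))).congr_of_eqOn (h := D₂ ω₁ ω₂ C) hV hp
      fun q hq => by rw [hC2 q hq]; ring
    have dX := ((hd hC1s p hp).sub ((hd hC p hp).mul (hd hB p hp))).add
      ((hd hα p hp).mul (hd hC p hp))
    rw [d2.D₁_eq, hC2 p hp, hg1 p hp] at k
    rw [dX.D₂_eq, hC2 p hp]
    simp only [hX, hY] at k ⊢
    linear_combination -k - C p * D₁_beta hV hω hp
  · have k := D_commutator hV hω hB hp
    have d1 := ((((hd hB p hp).mul (hd hB p hp)).add ((hd hg p hp).mul (hd hB p hp))).sub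
      ((hd hα p hp).mul (hd hB p hp))).congr_of_eqOn (h := D₁ ω₁ ω₂ B) hV hp
      fun q hq => by rw [hB1 q hq]; ring
    have dY := (((hd hC p hp).mul (hd hB p hp)).sub ((hd hβ p hp).mul (hd hB p hp))).sub
      (hd hB2s p hp)
    rw [d1.D₂_eq, hB1 p hp, hg2 p hp] at k
    rw [dY.D₁_eq, hB1 p hp]
    simp only [hX, hY] at k ⊢
    linear_combination -k - B p * D₁_beta hV hω hp

/-- The second derivatives of `g`, and the relation that the commutation rule imposes on them. -/
theorem IntegrabilityEquations.compatibility (hV : IsOpen V) (hω : IsNormalizedWeb V ω₁ ω₂)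
    {g X Y : Plane 𝕜 → 𝕜} (h : IntegrabilityEquations ω₁ ω₂ V g X Y) {p : Plane 𝕜} (hp : p ∈ V) :
    HasFrameDerivAt ω₁ ω₂ (D₁ ω₁ ω₂ g)
      (-(D₁ ω₁ ω₂ (alpha ω₁ ω₂) p * g p + alpha ω₁ ω₂ p * D₁ ω₁ ω₂ g p) - 2 * D₁ ω₁ ω₂ X p -
        D₁ ω₁ ω₂ Y p)
      (-(D₂ ω₁ ω₂ (alpha ω₁ ω₂) p * g p + alpha ω₁ ω₂ p * D₂ ω₁ ω₂ g p) - 2 * D₂ ω₁ ω₂ X p -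
        D₂ ω₁ ω₂ Y p) p ∧
    HasFrameDerivAt ω₁ ω₂ (D₂ ω₁ ω₂ g)
      (-(D₁ ω₁ ω₂ (beta ω₁ ω₂) p * g p + beta ω₁ ω₂ p * D₁ ω₁ ω₂ g p) + D₁ ω₁ ω₂ X p +
        2 * D₁ ω₁ ω₂ Y p)
      (-(D₂ ω₁ ω₂ (beta ω₁ ω₂) p * g p + beta ω₁ ω₂ p * D₂ ω₁ ω₂ g p) + D₂ ω₁ ω₂ X p +
        2 * D₂ ω₁ ω₂ Y p) p ∧
    D₁ ω₁ ω₂ X p + 2 * D₁ ω₁ ω₂ Y p + 2 * D₂ ω₁ ω₂ X p + D₂ ω₁ ω₂ Y p =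
      g p + 2 * beta ω₁ ω₂ p * D₁ ω₁ ω₂ g p - 2 * alpha ω₁ ω₂ p * D₂ ω₁ ω₂ g p := by
  have hd : ∀ {f : Plane 𝕜 → 𝕜}, ContDiffOn 𝕜 ∞ f V →
      HasFrameDerivAt ω₁ ω₂ f (D₁ ω₁ ω₂ f p) (D₂ ω₁ ω₂ f p) p :=
    fun hf => hasFrameDerivAt_of_contDiffOn hV hf hp
  have d1 := (((((HasFrameDerivAt.const 1).sub ((hd (contDiffOn_alpha hV hω)).mul
    (hd h.smooth_g))).sub ((hd h.smooth_X).const_mul 2)).sub (hd h.smooth_Y))).congr_of_eqOn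
      hV hp h.g₁
  have d2 := (((((HasFrameDerivAt.const (-1)).sub ((hd (contDiffOn_beta hV hω)).mul
    (hd h.smooth_g))).add (hd h.smooth_X)).add ((hd h.smooth_Y).const_mul 2))).congr_of_eqOn
      hV hp h.g₂
  refine ⟨d1.congr_deriv (by ring) (by ring), d2.congr_deriv (by ring) (by ring), ?_⟩
  have k := D_commutator hV hω h.smooth_g hp
  rw [d1.D₂_eq, d2.D₁_eq] at k
  linear_combination k + g p * D₁_beta hV hω hp

/-- Where the integrability equations hold and `g ≠ 0`, the function `N = 1/g` makes `Ω_N` flat. -/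
theorem IntegrabilityEquations.isFlat (hV : IsOpen V) (hω : IsNormalizedWeb V ω₁ ω₂)
    {g X Y : Plane 𝕜 → 𝕜} (h : IntegrabilityEquations ω₁ ω₂ V g X Y) (hg0 : ∀ p ∈ V, g p ≠ 0) :
    IsAdmissible (fun p => (g p)⁻¹) V ∧ IsFlat V (OmegaN ω₁ ω₂ fun p => (g p)⁻¹) := by
  have hN : IsAdmissible (fun p => (g p)⁻¹) V :=
    ⟨h.smooth_g.inv hg0, fun p hp => inv_ne_zero (hg0 p hp)⟩
  refine ⟨hN, (isFlat_OmegaN_iff hV hω hN).2 fun p hp => ?_⟩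
  have hdN : ∀ q ∈ V, HasFrameDerivAt ω₁ ω₂ (fun p => (g p)⁻¹)
      (-D₁ ω₁ ω₂ g q / g q ^ 2) (-D₂ ω₁ ω₂ g q / g q ^ 2) q := fun q hq =>
    (hasFrameDerivAt_of_contDiffOn hV h.smooth_g hq).inv (hg0 q hq)
  obtain ⟨d1, d2, hc⟩ := h.compatibility hV hω hp
  have hg := hasFrameDerivAt_of_contDiffOn (ω₁ := ω₁) (ω₂ := ω₂) hV h.smooth_g hp
  have hg0p := hg0 p hp
  have hi := hg.inv hg0p
  have e1 := (d1.neg.mul (hi.mul hi)).congr_of_eqOn (h := D₁ ω₁ ω₂ fun p => (g p)⁻¹) hV hp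
    fun q hq => by
      rw [(hdN q hq).D₁_eq]
      field_simp
  have e2 := (d2.neg.mul (hi.mul hi)).congr_of_eqOn (h := D₂ ω₁ ω₂ fun p => (g p)⁻¹) hV hp
    fun q hq => by
      rw [(hdN q hq).D₂_eq]
      field_simp
  have hb := D₁_beta hV hω hp
  rw [h.X₂ p hp, h.Y₁ p hp, h.g₁ p hp, h.g₂ p hp] at hc
  simp only [K₁₁, K₂₂]
  rw [e1.D₁_eq, e1.D₂_eq, e2.D₁_eq, e2.D₂_eq, (hdN p hp).D₁_eq, (hdN p hp).D₂_eq, hb,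
    h.X₂ p hp, h.Y₁ p hp, h.g₁ p hp, h.g₂ p hp]
  constructor
  · linear_combination (norm := (field_simp; ring)) (-(1 / (3 * g p))) * hc
  · linear_combination (norm := (field_simp; ring)) (-(1 / (3 * g p))) * hc

/-- The function `g` vanishes on no nonempty open set: there `X = Y = 1/3`, hence `α = β = 0`,
contrary to `β₁ - α₂ = 1`. -/
theorem IntegrabilityEquations.exists_ne_zero (hV : IsOpen V) (hω : IsNormalizedWeb V ω₁ ω₂)
    {g X Y : Plane 𝕜 → 𝕜} (h : IntegrabilityEquations ω₁ ω₂ V g X Y) {U : Set (Plane 𝕜)}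
    (hU : IsOpen U) (hUV : U ⊆ V) (hne : U.Nonempty) : ∃ p ∈ U, g p ≠ 0 := by
  by_contra! h0
  have hconst : ∀ {f : Plane 𝕜 → 𝕜} {k : 𝕜}, (∀ q ∈ U, f q = k) → ∀ p ∈ U,
      D₁ ω₁ ω₂ f p = 0 ∧ D₂ ω₁ ω₂ f p = 0 := fun hf p hp =>
    have := (HasFrameDerivAt.const (ω₁ := ω₁) (ω₂ := ω₂) (p := p) _).congr_of_eqOn hU hp hf
    ⟨this.D₁_eq, this.D₂_eq⟩
  have hX : ∀ p ∈ U, X p = 1 / 3 := by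
    intro p hp
    have e1 := h.g₁ p (hUV hp)
    have e2 := h.g₂ p (hUV hp)
    rw [(hconst h0 p hp).1, h0 p hp] at e1
    rw [(hconst h0 p hp).2, h0 p hp] at e2
    linear_combination (2 * e1 + e2) / 3
  have hY : ∀ p ∈ U, Y p = 1 / 3 := by
    intro p hp
    have e1 := h.g₁ p (hUV hp)
    rw [(hconst h0 p hp).1, h0 p hp, hX p hp] at e1
    linear_combination e1
  have hα : ∀ p ∈ U, alpha ω₁ ω₂ p = 0 := by
    intro p hp
    have e := h.Y₁ p (hUV hp)
    rw [(hconst hY p hp).1, h0 p hp, hY p hp] at e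
    linear_combination (3 / 2) * e
  have hβ : ∀ p ∈ U, beta ω₁ ω₂ p = 0 := by
    intro p hp
    have e := h.X₂ p (hUV hp)
    rw [(hconst hX p hp).2, h0 p hp, hX p hp] at e
    linear_combination (3 / 2) * e
  obtain ⟨p, hp⟩ := hne
  have e := D₁_beta hV hω (hUV hp)
  rw [(hconst hα p hp).2, (hconst hβ p hp).1] at e
  simp at e

/-- A linearization of the web on `U` yields a flat connection on some part of `U`. -/
theorem exists_isFlat_of_isLinearization {U : Set (Plane 𝕜)} (hU : IsOpen U) (hne : U.Nonempty)
    (hω : IsNormalizedWeb U ω₁ ω₂) {φ : Plane 𝕜 → Plane 𝕜} (hφ : IsLinearization ω₁ ω₂ U φ) :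
    ∃ O ⊆ U, IsOpen O ∧ O.Nonempty ∧ ∃ N : Plane 𝕜 → 𝕜,
      IsAdmissible N O ∧ IsFlat O (OmegaN ω₁ ω₂ N) := by
  obtain ⟨B, C, g, x, y, hB, hC, hg, hx, hy, hJ⟩ := exists_linear_system hU hω hφ
  obtain ⟨X, Y, h⟩ := exists_integrabilityEquations hU hω hB hC hg hx hy hJ
  obtain ⟨p, hp, hgp⟩ := h.exists_ne_zero hU hω hU subset_rfl hne
  have hO : IsOpen (U ∩ g ⁻¹' {0}ᶜ) :=
    hg.continuousOn.isOpen_inter_preimage hU isOpen_compl_singleton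
  have hOU : U ∩ g ⁻¹' {0}ᶜ ⊆ U := inter_subset_left
  exact ⟨U ∩ g ⁻¹' {0}ᶜ, hOU, hO, ⟨p, hp, hgp⟩, _, (h.mono hOU).isFlat hO (hω.mono hOU)
    fun q hq => hq.2⟩

/-! ### Locality and gluing -/

theorem OmegaN_apply_congr {N N' : Plane 𝕜 → 𝕜} {p : Plane 𝕜} (h : N =ᶠ[𝓝 p] N') (i j : Fin 3) :
    OmegaN ω₁ ω₂ N i j p = OmegaN ω₁ ω₂ N' i j p := by
  have h0 := h.self_of_nhds
  have h1 : D₁ ω₁ ω₂ N p = D₁ ω₁ ω₂ N' p := by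
    rw [D₁_eq_fderiv_frame, D₁_eq_fderiv_frame, h.fderiv_eq]
  have h2 : D₂ ω₁ ω₂ N p = D₂ ω₁ ω₂ N' p := by
    rw [D₂_eq_fderiv_frame, D₂_eq_fderiv_frame, h.fderiv_eq]
  simp only [OmegaN_eq, aFun, bFun, cFun, h0, h1, h2]

theorem curv_OmegaN_congr {N N' : Plane 𝕜 → 𝕜} {p : Plane 𝕜} (h : N =ᶠ[𝓝 p] N') (u v : Plane 𝕜) :
    curv (OmegaN ω₁ ω₂ N) p u v = curv (OmegaN ω₁ ω₂ N') p u v := by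
  ext i j
  have he : OmegaN ω₁ ω₂ N i j =ᶠ[𝓝 p] OmegaN ω₁ ω₂ N' i j := by
    filter_upwards [h.eventually_nhds] with q hq using OmegaN_apply_congr hq i j
  simp only [curv, Matrix.of_apply, wedge, extD_congr he, OmegaN_apply_congr h]

theorem Straightens.mono {θ : OneForm 𝕜} {U W : Set (Plane 𝕜)} {φ : Plane 𝕜 → Plane 𝕜}
    (h : Straightens θ U φ) (hW : W ⊆ U) : Straightens θ W φ :=
  fun s₀ r c hc => h s₀ r c ⟨hc.1, fun s hs => ⟨hW (hc.2 s hs).1, (hc.2 s hs).2⟩⟩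

theorem IsLinearization.mono {U W : Set (Plane 𝕜)} {φ : Plane 𝕜 → Plane 𝕜}
    (h : IsLinearization ω₁ ω₂ U φ) (hW : W ⊆ U) : IsLinearization ω₁ ω₂ W φ :=
  ⟨fun p => h.1 ⟨p, hW p.2⟩, h.2.1.mono hW, h.2.2.1.mono hW, h.2.2.2.mono hW⟩

/-- If every nonempty open subset of `W` has a nonempty open part with a flat connection `Ω_N`, then
so does an open dense subset of `W`, namely the union of a maximal disjoint family of such parts. -/
theorem exists_isFlat_isOpenDenseIn {W : Set (Plane 𝕜)} (hW : IsOpen W)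
    (h : ∀ U ⊆ W, IsOpen U → U.Nonempty → ∃ O ⊆ U, IsOpen O ∧ O.Nonempty ∧ ∃ N : Plane 𝕜 → 𝕜,
      IsAdmissible N O ∧ IsFlat O (OmegaN ω₁ ω₂ N)) :
    ∃ W₀, IsOpenDenseIn W₀ W ∧ ∃ N : Plane 𝕜 → 𝕜,
      IsAdmissible N W₀ ∧ IsFlat W₀ (OmegaN ω₁ ω₂ N) := by
  let P : Set (Plane 𝕜) → Prop := fun O => IsOpen O ∧ O ⊆ W ∧ ∃ N : Plane 𝕜 → 𝕜,
    IsAdmissible N O ∧ IsFlat O (OmegaN ω₁ ω₂ N)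
  obtain ⟨S, hS⟩ := zorn_subset
      {S : Set (Set (Plane 𝕜)) | (∀ O ∈ S, P O) ∧ S.PairwiseDisjoint id} <| by
    intro c hc hchain
    refine ⟨⋃₀ c, ⟨?_, ?_⟩, fun s hs => subset_sUnion_of_mem hs⟩
    · rintro O ⟨s, hs, hO⟩
      exact (hc hs).1 O hO
    · exact (pairwiseDisjoint_sUnion hchain.directedOn).2 fun s hs => (hc hs).2
  have hSP := hS.prop.1
  have hdisj := hS.prop.2
  choose! M hM using fun O hO => (hSP O hO).2.2
  -- the function that equals `M O` on each member `O` of the family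
  let N : Plane 𝕜 → 𝕜 := fun p => by
    classical exact if hp : ∃ O ∈ S, p ∈ O then M hp.choose p else 0
  have hN : ∀ O ∈ S, ∀ p ∈ O, N p = M O p := by
    intro O hO p hp
    have hex : ∃ O ∈ S, p ∈ O := ⟨O, hO, hp⟩
    have : hex.choose = O := hdisj.elim_set hex.choose_spec.1 hO p hex.choose_spec.2 hp
    simp only [N, dif_pos hex, this]
  have hNev : ∀ O ∈ S, ∀ p ∈ O, N =ᶠ[𝓝 p] M O := fun O hO p hp => by
    filter_upwards [(hSP O hO).1.mem_nhds hp] using hN O hO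
  refine ⟨⋃₀ S, ⟨isOpen_sUnion fun O hO => (hSP O hO).1, sUnion_subset fun O hO => (hSP O hO).2.1,
    ?_⟩, N, ⟨?_, ?_⟩, ?_⟩
  · by_contra hnot
    obtain ⟨q, hqW, hq⟩ := not_subset.1 hnot
    obtain ⟨O, hOU, hO, ⟨z, hz⟩, hON⟩ := h (W \ closure (⋃₀ S)) sdiff_subset
      (hW.sdiff isClosed_closure) ⟨q, hqW, hq⟩
    have hOS : O ∈ S := by
      refine hS.le_of_ge (y := insert O S) ⟨?_, ?_⟩ (subset_insert O S) (mem_insert O S)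
      · rintro Q (rfl | hQ)
        · exact ⟨hO, fun x hx => (hOU hx).1, hON⟩
        · exact hSP Q hQ
      · refine hdisj.insert fun Q hQ _ => disjoint_left.2 fun x hxO hxQ => ?_
        exact (hOU hxO).2 (subset_closure ⟨Q, hQ, hxQ⟩)
    exact (hOU hz).2 (subset_closure ⟨O, hOS, hz⟩)
  · rintro p ⟨O, hO, hp⟩
    exact (((hM O hO).1.1.contDiffAt ((hSP O hO).1.mem_nhds hp)).congr_of_eventuallyEq
      (hNev O hO p hp)).contDiffWithinAt
  · rintro p ⟨O, hO, hp⟩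
    rw [hN O hO p hp]
    exact (hM O hO).1.2 p hp
  · rintro p ⟨O, hO, hp⟩ u v
    rw [curv_OmegaN_congr (hNev O hO p hp)]
    exact (hM O hO).2 p hp u v

end PlanarWeb

end

theorem theorem1 {𝕜 : Type*} [RCLike 𝕜] (V : Set (Plane 𝕜)) (hV : IsOpen V)
    (ω₁ ω₂ : OneForm 𝕜) (hω : IsNormalizedWeb V ω₁ ω₂) :
    -- `Ω_N` is a torsion-free Cartan connection with the web leaves as geodesics
    (∀ N : Plane 𝕜 → 𝕜, IsAdmissible N V →
      IsCartanGauge V (OmegaN ω₁ ω₂ N) ∧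
      IsTorsionFree V (OmegaN ω₁ ω₂ N) ∧
      LeavesAreGeodesics ω₁ V (OmegaN ω₁ ω₂ N) ∧
      LeavesAreGeodesics ω₂ V (OmegaN ω₁ ω₂ N) ∧
      LeavesAreGeodesics (third ω₁ ω₂) V (OmegaN ω₁ ω₂ N) ∧
      (∀ p ∈ V, ∀ u v, curv (OmegaN ω₁ ω₂ N) p u v =
        wedge ω₁ ω₂ p u v •
          Matrix.of (fun _ : Fin 3 => ![K₁₁ ω₁ ω₂ N p, K₂₂ ω₁ ω₂ N p,
            -K₁₁ ω₁ ω₂ N p - K₂₂ ω₁ ω₂ N p])) ∧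
      (IsFlat V (OmegaN ω₁ ω₂ N) ↔
        ∀ p ∈ V, K₁₁ ω₁ ω₂ N p = 0 ∧ K₂₂ ω₁ ω₂ N p = 0)) ∧
    -- the linearization criterion, on the web and on each of its open parts
    (∀ W : Set (Plane 𝕜), IsOpen W → W ⊆ V →
      ((∃ W₀, IsOpenDenseIn W₀ W ∧
          ∀ p ∈ W₀, LinearizableNear ω₁ ω₂ p) ↔
        ∃ W₀, IsOpenDenseIn W₀ W ∧ ∃ N : Plane 𝕜 → 𝕜,
          IsAdmissible N W₀ ∧
          IsFlat W₀ (OmegaN ω₁ ω₂ N)) ∧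
      -- a flat connection linearizes near every point
      (∀ N : Plane 𝕜 → 𝕜, IsAdmissible N W →
        IsFlat W (OmegaN ω₁ ω₂ N) →
        ∀ p ∈ W, LinearizableNear ω₁ ω₂ p) ∧
      -- a linearization yields a flat connection on an open dense set
      (∀ φ, IsLinearization ω₁ ω₂ W φ →
        ∃ W₀, IsOpenDenseIn W₀ W ∧ ∃ N : Plane 𝕜 → 𝕜,
          IsAdmissible N W₀ ∧
          IsFlat W₀ (OmegaN ω₁ ω₂ N))) := by
  refine ⟨fun N hN => ?_, fun W hW hWV => ⟨⟨?_, ?_⟩, ?_, ?_⟩⟩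
  · have hΩ := contDiffOn_OmegaN hV hω hN
    have htr := trace_evalForm_OmegaN (ω₁ := ω₁) (ω₂ := ω₂) N
    exact ⟨isCartanGauge_OmegaN hV hω hN, isTorsionFree_OmegaN hV hω hN,
      isGeodesicArc_of_preservesFlag hΩ htr 0 fun _ _ => preservesFlag_leaf₁ N,
      isGeodesicArc_of_preservesFlag hΩ htr 1 fun _ _ => preservesFlag_leaf₂ N,
      isGeodesicArc_of_preservesFlag hΩ htr 2 fun _ _ => preservesFlag_leaf₃ N,
      fun p hp => curv_OmegaN hV hω hN hp, isFlat_OmegaN_iff hV hω hN⟩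
  · rintro ⟨W₀, ⟨hW₀, -, hdense⟩, hlin⟩
    refine exists_isFlat_isOpenDenseIn hW fun U hUW hU ⟨q, hq⟩ => ?_
    obtain ⟨p, hpU, hpW₀⟩ := mem_closure_iff.1 (hdense (hUW hq)) U hU hq
    obtain ⟨T, hT, hpT, φ, hφ⟩ := hlin p hpW₀
    obtain ⟨O, hOT, hO⟩ := exists_isFlat_of_isLinearization (hT.inter hU) ⟨p, hpT, hpU⟩
      (hω.mono (Set.inter_subset_right.trans (hUW.trans hWV))) (hφ.mono Set.inter_subset_left)
    exact ⟨O, hOT.trans Set.inter_subset_right, hO⟩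
  · rintro ⟨W₀, ⟨hW₀, hsub, hdense⟩, N, hN, hflat⟩
    exact ⟨W₀, ⟨hW₀, hsub, hdense⟩, fun p hp =>
      linearizableNear_of_isFlat hW₀ (hω.mono (hsub.trans hWV)) hN hflat hp⟩
  · exact fun N hN hflat p hp => linearizableNear_of_isFlat hW (hω.mono hWV) hN hflat hp
  · exact fun φ hφ => exists_isFlat_isOpenDenseIn hW fun U hUW hU hne =>
      exists_isFlat_of_isLinearization hU hne (hω.mono (hUW.trans hWV)) (hφ.mono hUW)
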